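/- **Setting.** A literal $a(x_1,\dots,x_k)$ consists of a label of arity $k$ and nodes from a fixed countably infinite set; a graph is a finite sequence of literals, $|g|$ is its length and $X(g)$ the set of nodes occurring in it. A hyperedge replacement (HR) grammar $\Gamma$ has terminal and nonterminal labels, a finite set of rules $A\to\varrho$ (a nonterminal literal and a graph) and a start literal $Z()$ of arity $0$. A rule is applied to a literal $A^\mu$ of a graph $g$, for an injective node renaming $\mu$ with $X(g)\cap X(\varrho^\mu)\subseteq X(A^\mu)$, by replacing $A^\mu$ with $\varrho^\mu$. $\Gamma$ is reduced if every rule is used in some derivation of a terminal graph from $Z()$. **dCFA.** An item $\langle A\to\alpha\,.\,\beta,\sigma\rangle$ is a dotted rule (or dotted production $\mathit{Start}\to Z$) with a partial map $\sigma$ (profile) from its nodes to parameters. The closure of a set of items adds $\langle A'\to .\,\varrho,\sigma'\rangle$ whenever an item $\langle A\to\alpha\,.\,B\beta,\sigma\rangle$ is present and $B=A'^\rho$ for an injective renaming $\rho$, where $\sigma'=\sigma\circ\rho$ on $X(A')$. The start state $Q_0$ is the closure of $\langle \mathit{Start}\to .\,Z,\emptyset\rangle$. A transition $Q\to Q'$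 is labelled with a literal over parameters of $Q$ and new nodes; it moves the dot over every next literal $B$ whose image under $\sigma$ (unknown nodes being new, pairwise distinct) is this label, makes all nodes of $B$ known, takes the closure and injectively renames the parameters. The dCFA consists of the set $\mathcal Q$ of states reachable from $Q_0$; it is assumed to be a finite automaton, i.e. the names are chosen so that $\mathcal Q$ is finite. **ASR parser.** $Q^\tau$ denotes a state with an input binding $\tau$, a partial map from parameters to nodes; $\iota$ is the empty binding. A configuration $(S,g)$ consists of a stack $S=Q_0^\iota e_1Q_1^{\tau_1}\cdots e_mQ_m^{\tau_m}$ and the graph $g$ read so far. A *shift move* with topmost element $Q^\tau$ follows a transition from $Q$ with a terminal label, reads a literal $e$ that is the instance of the label under $\tau$, where the new nodes are instantiated by distinct nodes neither bound by $\tau$ nor in $X(g)$, and leads to $(S\,e\,Q'^{\tau'},\,g\,e)$ with the resulting state and binding. A *reduce move* by an item $\langle A\to\varrho\,.,\sigma\rangle\in Q$ removes the topmost $|\varrho|$ literals, which must form $\varrho^{\tau\circ\sigma}$, together with their states, and pushes $A^{\tau\circ\sigma}$ and the state with binding that the dCFA reaches by this literal from the then topmost element (new nodes not occurring on the remaining stack).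 A state containing $\mathit{Start}\to Z\,.$ is accepting. **Conflicts.** A trigger of $Q$ is a terminal transition from $Q$ or a reduce item in $Q$ (an item with the dot at the end). $\mathit{Success}(Q^\tau,g',t)$ is the set of graphs $v$ such that from some configuration $(S,g')$ reached from $(Q_0^\iota,\varepsilon)$ with topmost element $Q^\tau$, a sequence of moves starting with one caused by $t$ leads to a configuration $(S_A,g'v)$ with accepting topmost state (for $t=(\mathit{Start}\to Z\,.)$, just $v=\varepsilon$, without a move). $f_Q^{\tau,g'}$ maps a node $x$ to the parameter $y$ of $Q$ with $\tau(y)=x$ if there is one, otherwise to "$-$" if $x\notin X(g')$, and to "$\bullet$" if $x \in X(g')$. $\mathit{Follow}(Q,t)$ (resp. $\mathit{Follow}^*(Q,t)$) is the set of all $f_Q^{\tau,g'}$-images of the first literal (resp. of all literals) of graphs $v\in\mathit{Success}(Q^\tau,g',t)$, for all $\tau,g'$, where $v=\varepsilon$ contributes the symbol $\$$. For triggers $t\ne t'$ of $Q$, $t\prec t'$ means $\mathit{Follow}^*(Q,t)\cap\mathit{Follow}(Q,t')\neq\varnothing$. $Q$ has a conflict if there are triggers $t_1\prec t_2\prec\dots\prec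 t_k\prec t_1$ of $Q$, $k\ge1$. **Theorem.** Let $\Gamma$ be a reduced HR grammar with a (finite) dCFA such that, for every reduce item $\langle A\to\varrho\,.,\sigma\rangle$ in a state, $\sigma$ is defined on all nodes of $A$ (so that $A^{\tau\circ\sigma}$ is always defined). Suppose that no state $Q\in\mathcal Q$ has a conflict. Then: 1. There is a constant $c\in\mathbb N$ such that $n<c\cdot(|g_n|-|g_0|+1)$ for every sequence $(Q_0^\iota,\varepsilon)\vdash^*(S_0,g_0)\vdash(S_1,g_1)\vdash\cdots\vdash(S_n,g_n)$ of ASR moves in which $S_0$ is a prefix of $S_i$ for $i=1,\dots,n$. 2. There is a constant $c\in\mathbb N$ such that $n<c\cdot|g|+c$ for every sequence $(Q_0^\iota,\varepsilon)\vdash^n(S,g)$ of ASR moves; i.e., the ASR parser takes at most linearly many moves in the size of the graph read. -/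

import Mathlib

noncomputable section

namespace PSR

/-- A literal `a(x₁, …, x_k)`: a label together with the list of its attached nodes. -/
structure Literal (L X : Type*) where
  lab : L
  att : List X

/-- Renaming of the attached nodes of a literal. -/
def Literal.map {L X Y : Type*} (f : X → Y) (e : Literal L X) : Literal L Y :=
  ⟨e.lab, e.att.map f⟩

/-- `Inst f B e`: the partial function `f` is defined on all nodes of `B`, and `e = B^f`. -/
def Inst {L X : Type*} (f : X → Option ℕ) (B : Literal L X) (e : Literal L ℕ) : Prop :=
  e.lab = B.lab ∧ B.att.map f = e.att.map some

/-- Graphs are finite sequences of literals over the countably infinite set `ℕ` of nodes. -/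
abbrev Graph (L : Type*) := List (Literal L ℕ)

/-- The set `X(g)` of nodes that occur in `g`. -/
def nodes {L : Type*} (g : Graph L) : Set ℕ := {x | ∃ e ∈ g, x ∈ e.att}

/-! ### Hyperedge replacement grammars -/

structure Rule (L : Type*) where
  lhs : Literal L ℕ
  rhs : Graph L

structure HRGrammar (L : Type*) where
  arity : L → ℕ
  terminal : Set L
  rules : Finset (Rule L)
  start : L
  start_nonterminal : start ∉ terminal
  start_arity : arity start = 0
  lhs_nonterminal : ∀ r ∈ rules, r.lhs.lab ∉ terminal
  lhs_arity : ∀ r ∈ rules, r.lhs.att.length = arity r.lhs.lab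
  rhs_arity : ∀ r ∈ rules, ∀ e ∈ r.rhs, e.att.length = arity e.lab

/-- The start literal `Z()`. -/
def HRGrammar.startLit {L : Type*} (Γ : HRGrammar L) : Literal L ℕ := ⟨Γ.start, []⟩

/-- Application of the rule `r` to one literal of `g`, by an injective renaming `μ` (a match) that
makes the nodes generated by `r` distinct from all nodes of `g`. -/
def Rule.Apply {L : Type*} (r : Rule L) (g g' : Graph L) : Prop :=
  ∃ (f h : Graph L) (μ : ℕ → ℕ), Function.Injective μ ∧
    g = f ++ [r.lhs.map μ] ++ h ∧
    g' = f ++ r.rhs.map (Literal.map μ) ++ h ∧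
    nodes g ∩ nodes (r.rhs.map (Literal.map μ)) ⊆ {x | x ∈ (r.lhs.map μ).att}

/-- `g ⇒ g'`. -/
def HRGrammar.Derives {L : Type*} (Γ : HRGrammar L) (g g' : Graph L) : Prop :=
  ∃ r ∈ Γ.rules, r.Apply g g'

/-- A grammar is reduced if each of its rules is used in a derivation of some terminal graph
from the start literal. -/
def HRGrammar.Reduced {L : Type*} (Γ : HRGrammar L) : Prop :=
  ∀ r ∈ Γ.rules, ∃ g g' w : Graph L,
    Relation.ReflTransGen Γ.Derives [Γ.startLit] g ∧ r.Apply g g' ∧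
    Relation.ReflTransGen Γ.Derives g' w ∧ ∀ e ∈ w, e.lab ∈ Γ.terminal

/-! ### Items and the deterministic characteristic finite automaton (dCFA) -/

/-- An item `⟨A → α . β, σ⟩`. The production `none` stands for the additional production
`Start → Z`; `dot` is the length of `α`; the profile `σ = prof` maps those nodes of the production
that are already known to parameters (elements of `P`). -/
structure Item (L P : Type*) where
  prod : Option (Rule L)
  dot : ℕ
  prof : ℕ → Option P

/-- Renaming of the parameters of an item. -/
def Item.map {L P P' : Type*} (f : P → P') (it : Item L P) : Item L P' :=
  ⟨it.prod, it.dot, fun x => (it.prof x).map f⟩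

/-- The right-hand side of a production. -/
def HRGrammar.body {L : Type*} (Γ : HRGrammar L) : Option (Rule L) → Graph L
  | none => [Γ.startLit]
  | some r => r.rhs

/-- The literal right after the dot. -/
def HRGrammar.next {L P : Type*} (Γ : HRGrammar L) (it : Item L P) : Option (Literal L ℕ) :=
  (Γ.body it.prod)[it.dot]?

/-- Closure of a set of items: if the dot of an item stands before `B`, and `B` is the (renamed)
left-hand side of a rule `A → ϱ`, then the item `A → . ϱ` is added. Its profile is known for
precisely those nodes of `A` that correspond to known nodes of `B`. -/
inductive HRGrammar.Closure {L P : Type*} (Γ : HRGrammar L) (K : Set (Item L P)) : Item L P → Prop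
  | base (it : Item L P) : it ∈ K → Γ.Closure K it
  | predict (it : Item L P) (r : Rule L) (ρ : ℕ → ℕ) :
      Γ.Closure K it → r ∈ Γ.rules → Function.Injective ρ → Γ.next it = some (r.lhs.map ρ) →
      Γ.Closure K ⟨some r, 0, fun v => if v ∈ r.lhs.att then it.prof (ρ v) else none⟩

/-- States of the dCFA are sets of items. Their parameters are natural numbers. -/
abbrev State (L : Type*) := Set (Item L ℕ)

/-- The parameters of a set of items. -/
def params {L P : Type*} (Q : Set (Item L P)) : Set P :=
  {a | ∃ it ∈ Q, ∃ x, it.prof x = some a}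

/-- The literals that label transitions: `Sum.inl a` is the parameter `a` of the source state,
`Sum.inr j` is a new node, where `j` is the first position at which it is attached. -/
abbrev Label (L : Type*) := Literal L (ℕ ⊕ ℕ)

/-- The parameter for the node `u` of the literal `B`, or a name for `u` if `u` is not yet known. -/
def paramOf {L : Type*} (σ : ℕ → Option ℕ) (B : Literal L ℕ) (u : ℕ) : ℕ ⊕ ℕ :=
  match σ u with
  | some a => Sum.inl a
  | none => Sum.inr (B.att.idxOf u)

/-- The transition label for moving the dot of an item with profile `σ` across `B`. -/
def labelOf {L : Type*} (σ : ℕ → Option ℕ) (B : Literal L ℕ) : Label L :=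
  B.map (paramOf σ B)

/-- The profile after moving the dot across `B`: now, all nodes of `B` are known. -/
def profAfter {L : Type*} (σ : ℕ → Option ℕ) (B : Literal L ℕ) (u : ℕ) : Option (ℕ ⊕ ℕ) :=
  if u ∈ B.att then some (paramOf σ B u) else (σ u).map Sum.inl

/-- `Q` has an outgoing transition labelled `ℓ`. -/
def HRGrammar.HasTransition {L : Type*} (Γ : HRGrammar L) (Q : State L) (ℓ : Label L) : Prop :=
  ∃ it ∈ Q, ∃ B, Γ.next it = some B ∧ labelOf it.prof B = ℓ

/-- The items obtained by moving the dot across `ℓ`. -/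
def HRGrammar.kernel {L : Type*} (Γ : HRGrammar L) (Q : State L) (ℓ : Label L) :
    Set (Item L (ℕ ⊕ ℕ)) :=
  {it' | ∃ it ∈ Q, ∃ B, Γ.next it = some B ∧ labelOf it.prof B = ℓ ∧
    it' = ⟨it.prod, it.dot + 1, profAfter it.prof B⟩}

/-- The successor of `Q` before its parameters are renamed. -/
def HRGrammar.rawSucc {L : Type*} (Γ : HRGrammar L) (Q : State L) (ℓ : Label L) :
    Set (Item L (ℕ ⊕ ℕ)) :=
  {it | Γ.Closure (Γ.kernel Q ℓ) it}

/-- The powerset construction identifies states by renaming parameters. A naming scheme tells, for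
every transition, how the old parameters and the new nodes are named in the target state. -/
abbrev Naming (L : Type*) := State L → Label L → (ℕ ⊕ ℕ ≃ ℕ)

/-- The target `Q'` of the transition `Q →(ℓ, μ) Q'`, where `μ = (nm Q ℓ).symm` maps the parameters
of `Q'` to parameters of `Q` and new nodes of `ℓ`. -/
def HRGrammar.target {L : Type*} (Γ : HRGrammar L) (nm : Naming L) (Q : State L) (ℓ : Label L) :
    State L :=
  Item.map (nm Q ℓ) '' Γ.rawSucc Q ℓ

/-- The start state `Q₀`. -/
def HRGrammar.startState {L : Type*} (Γ : HRGrammar L) : State L :=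
  {it | Γ.Closure {⟨none, 0, fun _ => none⟩} it}

inductive HRGrammar.IsState {L : Type*} (Γ : HRGrammar L) (nm : Naming L) : State L → Prop
  | start : Γ.IsState nm Γ.startState
  | trans (Q : State L) (ℓ : Label L) :
      Γ.IsState nm Q → Γ.HasTransition Q ℓ → Γ.IsState nm (Γ.target nm Q ℓ)

/-- The set `𝒬` of states of the dCFA. -/
def HRGrammar.states {L : Type*} (Γ : HRGrammar L) (nm : Naming L) : Set (State L) :=
  {Q | Γ.IsState nm Q}

/-- In every reduce item `⟨A → ϱ . , σ⟩` of a dCFA state, `σ` is defined on all nodes of `A`, i.e.,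
the literal `A^(τ ∘ σ)` that a reduce move pushes onto the stack is always defined. -/
def HRGrammar.LhsKnown {L : Type*} (Γ : HRGrammar L) (nm : Naming L) : Prop :=
  ∀ Q ∈ Γ.states nm, ∀ (r : Rule L) (σ : ℕ → Option ℕ),
    (⟨some r, r.rhs.length, σ⟩ : Item L ℕ) ∈ Q → ∀ x ∈ r.lhs.att, σ x ≠ none

/-! ### The assisted shift-reduce (ASR) parser -/

/-- Input bindings: partial functions from parameters to nodes. -/
abbrev Binding := ℕ → Option ℕ

/-- A state with an input binding, `Q^τ`. -/
structure BState (L : Type*) where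
  state : State L
  bind : Binding

/-- `Q₀^ι` with the empty binding `ι`. -/
def HRGrammar.initial {L : Type*} (Γ : HRGrammar L) : BState L := ⟨Γ.startState, fun _ => none⟩

/-- The extension of a binding `τ` to the new nodes of a label by `ν`. -/
def extend (τ : Binding) (ν : ℕ → ℕ) : ℕ ⊕ ℕ → Option ℕ :=
  Sum.elim τ (fun j => some (ν j))

open Classical in
/-- The binding `τ' = extend τ ν ∘ μ` of the parameters of the target state of a transition. -/
def HRGrammar.targetBind {L : Type*} (Γ : HRGrammar L) (nm : Naming L) (Q : State L) (ℓ : Label L)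
    (τ : Binding) (ν : ℕ → ℕ) : Binding := fun a =>
  if a ∈ params (Γ.target nm Q ℓ) then extend τ ν ((nm Q ℓ).symm a) else none

/-- The dCFA reads the literal `e` in `Q^τ` by the transition labelled `ℓ` and reaches `q'`.
The binding `τ` is extended to the new nodes of `ℓ` by `ν`; these nodes must be pairwise distinct,
and they must neither be bound by `τ` nor belong to the set `V` of nodes used already. -/
def HRGrammar.Read {L : Type*} (Γ : HRGrammar L) (nm : Naming L) (V : Set ℕ)
    (q : BState L) (ℓ : Label L) (e : Literal L ℕ) (q' : BState L) : Prop :=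
  Γ.HasTransition q.state ℓ ∧
  ∃ ν : ℕ → ℕ,
    Set.InjOn ν {j | Sum.inr j ∈ ℓ.att} ∧
    (∀ j, Sum.inr j ∈ ℓ.att → ν j ∉ V ∧ ∀ a, q.bind a ≠ some (ν j)) ∧
    Inst (extend q.bind ν) ℓ e ∧
    q' = ⟨Γ.target nm q.state ℓ, Γ.targetBind nm q.state ℓ q.bind ν⟩

/-- Parse stacks `Q₀^ι e₁ Q₁^τ₁ … e_m Q_m^τ_m`, from bottom to top; the bottom element `Q₀^ι` is
left implicit. -/
abbrev Stack (L : Type*) := List (Literal L ℕ × BState L)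

/-- The topmost state of a stack. -/
def HRGrammar.top {L : Type*} (Γ : HRGrammar L) (S : Stack L) : BState L :=
  match S.getLast? with
  | none => Γ.initial
  | some p => p.2

/-- The graph stored on a stack. -/
def stackGraph {L : Type*} (S : Stack L) : Graph L := S.map Prod.fst

/-- A configuration: a stack and the graph read so far. -/
structure Config (L : Type*) where
  stack : Stack L
  graph : Graph L

/-- Triggers: transitions (given by their label) and reduce items. -/
inductive Trigger (L : Type*)
  | trans (ℓ : Label L)
  | item (it : Item L ℕ)

/-- The triggers of a state. -/
inductive HRGrammar.IsTrigger {L : Type*} (Γ : HRGrammar L) (Q : State L) : Trigger L → Prop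
  | trans (ℓ : Label L) : ℓ.lab ∈ Γ.terminal → Γ.HasTransition Q ℓ → Γ.IsTrigger Q (.trans ℓ)
  | item (it : Item L ℕ) : it ∈ Q → it.dot = (Γ.body it.prod).length → Γ.IsTrigger Q (.item it)

/-- ASR moves caused by a trigger. A shift move reads a terminal literal whose new nodes have not
been read before. A reduce move by `⟨A → ϱ . , σ⟩` in `Q^τ` replaces the handle `ϱ^(τ ∘ σ)` on top
of the stack by `A^(τ ∘ σ)`. -/
inductive HRGrammar.Move {L : Type*} (Γ : HRGrammar L) (nm : Naming L) :
    Trigger L → Config L → Config L → Prop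
  | shift (S : Stack L) (g : Graph L) (ℓ : Label L) (e : Literal L ℕ) (q' : BState L) :
      e.lab ∈ Γ.terminal →
      Γ.Read nm (nodes g) (Γ.top S) ℓ e q' →
      Γ.Move nm (.trans ℓ) ⟨S, g⟩ ⟨S ++ [(e, q')], g ++ [e]⟩
  | reduce (S S' : Stack L) (g : Graph L) (r : Rule L) (σ : ℕ → Option ℕ)
      (ℓ : Label L) (A : Literal L ℕ) (q' : BState L) :
      (⟨some r, r.rhs.length, σ⟩ : Item L ℕ) ∈ (Γ.top (S ++ S')).state →
      List.Forall₂ (Inst (fun x => (σ x).bind (Γ.top (S ++ S')).bind)) r.rhs (stackGraph S') →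
      Inst (fun x => (σ x).bind (Γ.top (S ++ S')).bind) r.lhs A →
      Γ.Read nm (nodes (stackGraph S)) (Γ.top S) ℓ A q' →
      Γ.Move nm (.item ⟨some r, r.rhs.length, σ⟩) ⟨S ++ S', g⟩ ⟨S ++ [(A, q')], g⟩

/-- ASR moves. -/
def HRGrammar.Step {L : Type*} (Γ : HRGrammar L) (nm : Naming L) (c c' : Config L) : Prop :=
  ∃ t, Γ.Move nm t c c'

/-- The initial configuration. -/
def HRGrammar.initConfig {L : Type*} (_ : HRGrammar L) : Config L := ⟨[], []⟩

/-- Configurations reached by the ASR parser. -/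
def HRGrammar.Reached {L : Type*} (Γ : HRGrammar L) (nm : Naming L) (c : Config L) : Prop :=
  Relation.ReflTransGen (Γ.Step nm) Γ.initConfig c

/-- `it` is the item `Start → Z .` that causes acceptance. -/
def IsAcceptItem {L : Type*} (it : Item L ℕ) : Prop := it.prod = none ∧ it.dot = 1

/-- `Q` is the accepting state. -/
def Accepting {L : Type*} (Q : State L) : Prop := ∃ it ∈ Q, IsAcceptItem it

/-! ### Follow sets and conflicts -/

/-- `Success(Q^τ, g', t)`: the graphs processed by successful sequences caused by the trigger `t`
when the parser has reached a configuration with topmost state `Q^τ` and read graph `g'`. The item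
`Start → Z .` causes acceptance without any further move. -/
def HRGrammar.Success {L : Type*} (Γ : HRGrammar L) (nm : Naming L) (q : BState L) (g' : Graph L)
    (t : Trigger L) : Set (Graph L) :=
  {v | ∃ S : Stack L, Γ.top S = q ∧ Γ.Reached nm ⟨S, g'⟩ ∧
    ((∃ (c : Config L) (SA : Stack L), Γ.Move nm t ⟨S, g'⟩ c ∧
        Relation.ReflTransGen (Γ.Step nm) c ⟨SA, g' ++ v⟩ ∧ Accepting (Γ.top SA).state) ∨
     (∃ it ∈ q.state, IsAcceptItem it ∧ t = .item it ∧ v = []))}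

/-- Nodes of pseudo-literals: a parameter, `–` (not read so far), or `•` (read, but not bound). -/
inductive PNode
  | param (a : ℕ)
  | fresh
  | bullet

open Classical in
/-- The function `f_Q^{τ,g'}` on nodes. -/
def pnode {L : Type*} (q : BState L) (g' : Graph L) (x : ℕ) : PNode :=
  if h : ∃ y, y ∈ params q.state ∧ q.bind y = some x then .param h.choose
  else if x ∉ nodes g' then .fresh
  else .bullet

/-- Pseudo-literals, and the symbol `$`, which is represented by `none`. -/
abbrev Pseudo (L : Type*) := Option (Literal L PNode)

/-- The function `f_Q^{τ,g'}` on literals and `$`. -/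
def pseudo {L : Type*} (q : BState L) (g' : Graph L) (e : Option (Literal L ℕ)) : Pseudo L :=
  e.map (Literal.map (pnode q g'))

/-- `First(h)` is the first literal of `h`, and `$` if `h` is empty. -/
def First {L : Type*} (h : Graph L) : Option (Literal L ℕ) := h.head?

/-- `Any(h)` is the set of all literals of `h`, and `{$}` if `h` is empty. -/
def Any {L : Type*} (h : Graph L) : Set (Option (Literal L ℕ)) :=
  {o | (∃ e ∈ h, o = some e) ∨ (h = [] ∧ o = none)}

/-- `Follow(Q, t)`. -/
def HRGrammar.Follow {L : Type*} (Γ : HRGrammar L) (nm : Naming L) (Q : State L) (t : Trigger L) :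
    Set (Pseudo L) :=
  {p | ∃ (τ : Binding) (g' : Graph L), ∃ v ∈ Γ.Success nm ⟨Q, τ⟩ g' t,
    p = pseudo ⟨Q, τ⟩ g' (First v)}

/-- `Follow*(Q, t)`. -/
def HRGrammar.FollowStar {L : Type*} (Γ : HRGrammar L) (nm : Naming L) (Q : State L)
    (t : Trigger L) : Set (Pseudo L) :=
  {p | ∃ (τ : Binding) (g' : Graph L), ∃ v ∈ Γ.Success nm ⟨Q, τ⟩ g' t, ∃ o ∈ Any v,
    p = pseudo ⟨Q, τ⟩ g' o}

/-- `t ≺ t'` for triggers of `Q`. -/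
def HRGrammar.Precedes {L : Type*} (Γ : HRGrammar L) (nm : Naming L) (Q : State L)
    (t t' : Trigger L) : Prop :=
  Γ.IsTrigger Q t ∧ Γ.IsTrigger Q t' ∧ t ≠ t' ∧ (Γ.FollowStar nm Q t ∩ Γ.Follow nm Q t').Nonempty

/-- A set of triggers of `Q` is in conflict if it has the form `{t₀, …, t_k}` with
`t₀ ≺ t₁ ≺ ⋯ ≺ t_k ≺ t₀`; the addition in `Fin (k + 1)` is cyclic. -/
def HRGrammar.InConflict {L : Type*} (Γ : HRGrammar L) (nm : Naming L) (Q : State L)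
    (T : Set (Trigger L)) : Prop :=
  ∃ (k : ℕ) (t : Fin (k + 1) → Trigger L), T = Set.range t ∧
    ∀ i, Γ.Precedes nm Q (t i) (t (i + 1))

/-- `Q` has no conflicts. -/
def HRGrammar.ConflictFree {L : Type*} (Γ : HRGrammar L) (nm : Naming L) (Q : State L) : Prop :=
  ∀ T : Set (Trigger L), (∀ t ∈ T, Γ.IsTrigger Q t) → ¬ Γ.InConflict nm Q T

end PSR

end

namespace PSR

variable {L : Type*} {Γ : HRGrammar L} {nm : Naming L}

/-! ### Instances of literals -/

/-! Two facts are played against each other. First, once the grammar has a rule, every reached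
configuration can be continued to acceptance: reducedness makes all right-hand sides productive, so
the literals after a dot can be read one by one, and known left-hand sides make the resulting
reductions possible (`Config.Proper.completable`). Second, if two distinct triggers of a state
succeed on the same graph `v`, with the same binding and the same graph read, then each precedes the
other, which is a conflict. So in a conflict-free parser the remaining graph determines the next
trigger.

Suppose that reduce moves lead from a stack `P W` to `P Y W` without touching `P`, where `P Y` and
`P` have the same topmost state and binding. The loop can be repeated above `P Y`. But a finite
successful continuation exists after the loop, and conflict-freeness forces each of its moves to
copy the loop, so it can never end: `HRGrammar.ConflictFree.no_loop`.

Consequently, in a sequence of reduce moves no stack recurs, and the states with bindings above the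
initial height are pairwise distinct. If the stack never gets lower than initially, all nodes bound
in that region were already bound by the two topmost initial states. Up to an encoding of these
boundedly many nodes, only finitely many states with bindings remain, and each determines the
literal below it. So the number of stacks, hence of moves, has a bound `c` independent of the input
(`exists_reduceRun_bound`).

An arbitrary sequence is cut into such runs. A run ends with the sequence, with a shift, which is
paid for by a literal, or with a reduction below the initial height, which is paid for by the stack
height as a potential (`amortized_bound`). -/

theorem Inst.det {X : Type*} {f : X → Option ℕ} {B : Literal L X} {e e' : Literal L ℕ}
    (h : Inst f B e) (h' : Inst f B e') : e = e' := by
  obtain ⟨l, a⟩ := e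
  obtain ⟨l', a'⟩ := e'
  obtain ⟨h1, h2⟩ := h
  obtain ⟨h1', h2'⟩ := h'
  have h3 : a = a' := List.map_injective_iff.2 (Option.some_injective _) (h2.symm.trans h2')
  have h4 : l = l' := h1.trans h1'.symm
  rw [h3, h4]

theorem Inst.exists_node {X : Type*} {f : X → Option ℕ} {B : Literal L X} {e : Literal L ℕ}
    (h : Inst f B e) {y : ℕ} (hy : y ∈ e.att) : ∃ x ∈ B.att, f x = some y := by
  have h1 : some y ∈ e.att.map some := List.mem_map_of_mem hy
  rw [← h.2] at h1
  simpa using h1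

theorem Inst.exists_image {X : Type*} {f : X → Option ℕ} {B : Literal L X} {e : Literal L ℕ}
    (h : Inst f B e) {x : X} (hx : x ∈ B.att) : ∃ y ∈ e.att, f x = some y := by
  have h1 : f x ∈ B.att.map f := List.mem_map_of_mem hx
  rw [h.2, List.mem_map] at h1
  obtain ⟨y, hy, hxy⟩ := h1
  exact ⟨y, hy, hxy.symm⟩

theorem Inst.congr {X Y : Type*} {f : X → Option ℕ} {f' : Y → Option ℕ} {C : Literal L X}
    {e : Literal L ℕ} (h : Inst f C e) (m : X → Y) (hm : ∀ x ∈ C.att, f' (m x) = f x) :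
    Inst f' (C.map m) e := by
  refine ⟨h.1, ?_⟩
  rw [← h.2]
  simpa [Literal.map] using hm

theorem Inst.of_map {X Y : Type*} {f : X → Option ℕ} {f' : Y → Option ℕ} {C : Literal L X}
    {e : Literal L ℕ} {m : X → Y} (h : Inst f' (C.map m) e) (hm : ∀ x ∈ C.att, f' (m x) = f x) :
    Inst f C e := by
  refine ⟨h.1, ?_⟩
  rw [← h.2]
  simp only [Literal.map, List.map_map]
  exact List.map_congr_left fun x hx => (hm x hx).symm

theorem Inst.mono {X : Type*} {f f' : X → Option ℕ} {B : Literal L X} {e : Literal L ℕ}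
    (h : Inst f B e) (hf : ∀ x y, f x = some y → f' x = some y) : Inst f' B e := by
  refine ⟨h.1, ?_⟩
  rw [← h.2]
  refine List.map_congr_left fun x hx => ?_
  obtain ⟨y, -, hy⟩ := h.exists_image hx
  rw [hy, hf x y hy]

theorem exists_inst {X : Type*} {f : X → Option ℕ} {B : Literal L X}
    (h : ∀ x ∈ B.att, f x ≠ none) : ∃ e, Inst f B e := by
  refine ⟨⟨B.lab, B.att.map fun x => (f x).getD 0⟩, rfl, ?_⟩
  rw [List.map_map]
  refine List.map_congr_left fun x hx => ?_
  obtain ⟨y, hy⟩ := Option.ne_none_iff_exists'.1 (h x hx)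
  simp [hy]

/-! ### Items of states -/

theorem HRGrammar.Closure.mem_params {P : Type*} {K : Set (Item L P)} {it : Item L P}
    (h : Γ.Closure K it) {x : ℕ} {a : P} (hx : it.prof x = some a) : a ∈ params K := by
  induction h generalizing x with
  | base it hit => exact ⟨it, hit, x, hx⟩
  | predict it r ρ _ _ _ _ ih =>
    dsimp only at hx
    split_ifs at hx
    exact ih hx

theorem HRGrammar.Closure.mem_of_dot_ne_zero {P : Type*} {K : Set (Item L P)} {it : Item L P}
    (h : Γ.Closure K it) (hd : it.dot ≠ 0) : it ∈ K := by
  cases h with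
  | base it hit => exact hit
  | predict it r ρ _ _ _ _ => exact absurd rfl hd

/-- Items with rules of the grammar, a legal position of the dot and an injective profile. -/
structure Item.Proper {P : Type*} (Γ : HRGrammar L) (it : Item L P) : Prop where
  mem_rules : ∀ r, it.prod = some r → r ∈ Γ.rules
  dot_le : it.dot ≤ (Γ.body it.prod).length
  inj : ∀ x y a, it.prof x = some a → it.prof y = some a → x = y

theorem HRGrammar.Closure.proper {P : Type*} {K : Set (Item L P)} (hK : ∀ it ∈ K, it.Proper Γ)
    {it : Item L P} (h : Γ.Closure K it) : it.Proper Γ := by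
  induction h with
  | base it hit => exact hK it hit
  | predict it r ρ _ hr hρ _ ih =>
    refine ⟨?_, Nat.zero_le _, ?_⟩
    · intro r' hr'
      cases hr'
      exact hr
    · intro x y a hx hy
      dsimp only at hx hy
      split_ifs at hx hy
      exact hρ (ih.inj _ _ _ hx hy)

theorem paramOf_of_some {σ : ℕ → Option ℕ} {B : Literal L ℕ} {u a : ℕ} (h : σ u = some a) :
    paramOf σ B u = Sum.inl a := by simp [paramOf, h]

theorem paramOf_of_none {σ : ℕ → Option ℕ} {B : Literal L ℕ} {u : ℕ} (h : σ u = none) :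
    paramOf σ B u = Sum.inr (B.att.idxOf u) := by simp [paramOf, h]

theorem profAfter_of_mem {σ : ℕ → Option ℕ} {B : Literal L ℕ} {u : ℕ} (h : u ∈ B.att) :
    profAfter σ B u = some (paramOf σ B u) := by simp [profAfter, h]

theorem profAfter_eq_inl {σ : ℕ → Option ℕ} {B : Literal L ℕ} {u a : ℕ} :
    profAfter σ B u = some (Sum.inl a) ↔ σ u = some a := by
  rcases h : σ u with _ | b <;> simp [profAfter, paramOf, h]

theorem profAfter_eq_inr {σ : ℕ → Option ℕ} {B : Literal L ℕ} {u j : ℕ} :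
    profAfter σ B u = some (Sum.inr j) ↔ u ∈ B.att ∧ σ u = none ∧ B.att.idxOf u = j := by
  rcases h : σ u with _ | b <;> simp [profAfter, paramOf, h]

theorem profAfter_inj {σ : ℕ → Option ℕ} (hσ : ∀ x y a, σ x = some a → σ y = some a → x = y)
    {B : Literal L ℕ} {x y : ℕ} {a : ℕ ⊕ ℕ} (hx : profAfter σ B x = some a)
    (hy : profAfter σ B y = some a) : x = y := by
  rcases a with a | j
  · rw [profAfter_eq_inl] at hx hy
    exact hσ _ _ _ hx hy
  · rw [profAfter_eq_inr] at hx hy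
    exact (List.idxOf_inj hx.1).1 (hx.2.2.trans hy.2.2.symm)

theorem inr_mem_labelOf {σ : ℕ → Option ℕ} {B : Literal L ℕ} {j : ℕ} :
    Sum.inr j ∈ (labelOf σ B).att ↔ ∃ u ∈ B.att, σ u = none ∧ B.att.idxOf u = j := by
  simp only [labelOf, Literal.map, List.mem_map]
  refine exists_congr fun u => and_congr_right fun _ => ?_
  rcases h : σ u with _ | b <;> simp [paramOf, h]

theorem next_lt {P : Type*} {it : Item L P} {B : Literal L ℕ} (h : Γ.next it = some B) :
    it.dot < (Γ.body it.prod).length := (List.getElem?_eq_some_iff.1 h).1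

theorem kernel_proper {Q : State L} (hQ : ∀ it ∈ Q, it.Proper Γ) {ℓ : Label L}
    {it : Item L (ℕ ⊕ ℕ)} (h : it ∈ Γ.kernel Q ℓ) : it.Proper Γ := by
  obtain ⟨it, hit, B, hB, -, rfl⟩ := h
  exact ⟨(hQ it hit).mem_rules, next_lt hB, fun x y a => profAfter_inj (hQ it hit).inj⟩

theorem Item.Proper.map {P P' : Type*} {it : Item L P} (h : it.Proper Γ) {f : P → P'}
    (hf : Function.Injective f) : (it.map f).Proper Γ := by
  refine ⟨h.mem_rules, h.dot_le, fun x y a hx hy => ?_⟩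
  simp only [Item.map, Option.map_eq_some_iff] at hx hy
  obtain ⟨b, hb, rfl⟩ := hx
  obtain ⟨c, hc, hbc⟩ := hy
  rw [hf hbc] at hc
  exact h.inj _ _ _ hb hc

theorem HRGrammar.IsState.proper {Q : State L} (h : Γ.IsState nm Q) : ∀ it ∈ Q, it.Proper Γ := by
  induction h with
  | start =>
    refine fun it hit => HRGrammar.Closure.proper ?_ hit
    rintro it rfl
    exact ⟨by simp, Nat.zero_le _, by simp⟩
  | trans Q ℓ _ _ ih =>
    rintro _ ⟨it, hit, rfl⟩
    exact (HRGrammar.Closure.proper (fun _ => kernel_proper ih) hit).map (nm Q ℓ).injective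

theorem params_startState : params Γ.startState = ∅ := by
  refine Set.eq_empty_of_forall_notMem ?_
  rintro a ⟨it, hit, x, hx⟩
  obtain ⟨_, rfl, _, hy⟩ := HRGrammar.Closure.mem_params hit hx
  simp at hy

theorem mem_params_target {Q : State L} {ℓ : Label L} {a : ℕ}
    (h : a ∈ params (Γ.target nm Q ℓ)) :
    (∃ b ∈ params Q, (nm Q ℓ).symm a = Sum.inl b) ∨
      ∃ j, Sum.inr j ∈ ℓ.att ∧ (nm Q ℓ).symm a = Sum.inr j := by
  obtain ⟨_, ⟨it, hit, rfl⟩, x, hx⟩ := h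
  simp only [Item.map, Option.map_eq_some_iff] at hx
  obtain ⟨b, hb, rfl⟩ := hx
  rw [Equiv.symm_apply_apply]
  obtain ⟨_, ⟨it', hit', B, hB, rfl, rfl⟩, y, hy⟩ := HRGrammar.Closure.mem_params hit hb
  rcases b with b | j
  · exact .inl ⟨b, ⟨it', hit', y, profAfter_eq_inl.1 hy⟩, rfl⟩
  · exact .inr ⟨j, inr_mem_labelOf.2 ⟨y, profAfter_eq_inr.1 hy⟩, rfl⟩

theorem HRGrammar.IsState.finite_params {Q : State L} (h : Γ.IsState nm Q) : (params Q).Finite := by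
  induction h with
  | start => rw [params_startState]; exact Set.finite_empty
  | trans Q ℓ _ _ ih =>
    refine ((ih.image fun b => nm Q ℓ (Sum.inl b)).union
      (ℓ.att.finite_toSet.image (nm Q ℓ))).subset fun a ha => ?_
    rcases mem_params_target ha with ⟨b, hb, hab⟩ | ⟨j, hj, hab⟩
    · exact .inl ⟨b, hb, by simp [← hab]⟩
    · exact .inr ⟨_, hj, by simp [← hab]⟩

/-- The item obtained by moving the dot of `it` across `B`, in the target state. -/
def Item.advance (nm : Naming L) (Q : State L) (it : Item L ℕ) (B : Literal L ℕ) : Item L ℕ :=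
  Item.map (nm Q (labelOf it.prof B)) ⟨it.prod, it.dot + 1, profAfter it.prof B⟩

theorem advance_mem_target {Q : State L} {it : Item L ℕ} (hit : it ∈ Q) {B : Literal L ℕ}
    (hB : Γ.next it = some B) : it.advance nm Q B ∈ Γ.target nm Q (labelOf it.prof B) :=
  ⟨_, .base _ ⟨it, hit, B, hB, rfl, rfl⟩, rfl⟩

/-! ### States with bindings -/

/-- The bindings of reachable stacks are injective and defined on precisely the parameters. -/
structure BState.Proper (Γ : HRGrammar L) (nm : Naming L) (q : BState L) : Prop where
  isState : Γ.IsState nm q.state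
  bind_ne_none : ∀ a, q.bind a ≠ none ↔ a ∈ params q.state
  inj : ∀ a b y, q.bind a = some y → q.bind b = some y → a = b

/-- The nodes that an item knows under a binding. -/
def Item.known (it : Item L ℕ) (τ : Binding) (x : ℕ) : Option ℕ := (it.prof x).bind τ

theorem initial_proper : BState.Proper Γ nm Γ.initial :=
  ⟨.start, by simp [HRGrammar.initial, params_startState], by simp [HRGrammar.initial]⟩

theorem BState.Proper.known_eq_none {q : BState L} (hq : q.Proper Γ nm) {it : Item L ℕ}
    (hit : it ∈ q.state) {x : ℕ} : it.known q.bind x = none ↔ it.prof x = none := by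
  constructor
  · intro h
    by_contra h'
    obtain ⟨a, ha⟩ := Option.ne_none_iff_exists'.1 h'
    rw [Item.known, ha] at h
    exact (hq.bind_ne_none a).2 ⟨it, hit, x, ha⟩ h
  · intro h
    simp [Item.known, h]

theorem BState.Proper.known_inj {q : BState L} (hq : q.Proper Γ nm) {it : Item L ℕ}
    (hit : it ∈ q.state) {x y z : ℕ} (hx : it.known q.bind x = some z)
    (hy : it.known q.bind y = some z) : x = y := by
  simp only [Item.known, Option.bind_eq_some_iff] at hx hy
  obtain ⟨a, ha, ha'⟩ := hx
  obtain ⟨b, hb, hb'⟩ := hy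
  rw [hq.inj _ _ _ hb' ha'] at hb
  exact (hq.isState.proper it hit).inj _ _ _ ha hb

theorem extend_inj {q : BState L} (hq : q.Proper Γ nm) {J : Set ℕ} {ν : ℕ → ℕ}
    (hν : Set.InjOn ν J) (hb : ∀ j ∈ J, ∀ a, q.bind a ≠ some (ν j)) {s t : ℕ ⊕ ℕ} {y : ℕ}
    (hs : ∀ j, s = Sum.inr j → j ∈ J) (ht : ∀ j, t = Sum.inr j → j ∈ J)
    (hsy : extend q.bind ν s = some y) (hty : extend q.bind ν t = some y) : s = t := by
  rcases s with a | i <;> rcases t with b | j <;> simp only [extend, Sum.elim_inl, Sum.elim_inr,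
    Option.some.injEq] at hsy hty
  · rw [hq.inj _ _ _ hsy hty]
  · exact absurd (hty ▸ hsy) (hb j (ht j rfl) a)
  · exact absurd (hsy ▸ hty) (hb i (hs i rfl) b)
  · rw [hν (hs i rfl) (ht j rfl) (hsy.trans hty.symm)]

theorem HRGrammar.Read.mono {V V' : Set ℕ} (hV : V' ⊆ V) {q q' : BState L} {ℓ : Label L}
    {e : Literal L ℕ} (h : Γ.Read nm V q ℓ e q') : Γ.Read nm V' q ℓ e q' := by
  obtain ⟨h1, ν, h2, h3, h4⟩ := h
  exact ⟨h1, ν, h2, fun j hj => ⟨fun hj' => (h3 j hj).1 (hV hj'), (h3 j hj).2⟩, h4⟩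

theorem HRGrammar.Read.bind_mem {V : Set ℕ} {q q' : BState L} {ℓ : Label L} {e : Literal L ℕ}
    (h : Γ.Read nm V q ℓ e q') {a y : ℕ} (hy : q'.bind a = some y) :
    (∃ b, q.bind b = some y) ∨ y ∈ e.att := by
  obtain ⟨-, ν, -, -, h4, rfl⟩ := h
  simp only [HRGrammar.targetBind] at hy
  split_ifs at hy with ha
  rcases mem_params_target ha with ⟨b, hb, hab⟩ | ⟨j, hj, hab⟩
  · rw [hab] at hy
    exact .inl ⟨b, hy⟩
  · rw [hab] at hy
    obtain ⟨z, hz, hz'⟩ := h4.exists_image hj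
    rw [hy] at hz'
    cases hz'
    exact .inr hz

theorem HRGrammar.Read.proper {V : Set ℕ} {q q' : BState L} (hq : q.Proper Γ nm) {ℓ : Label L}
    {e : Literal L ℕ} (h : Γ.Read nm V q ℓ e q') : q'.Proper Γ nm := by
  obtain ⟨h1, ν, h2, h3, h4, rfl⟩ := h
  refine ⟨.trans _ _ hq.isState h1, fun a => ?_, fun a b y ha hb => ?_⟩
  · dsimp only [HRGrammar.targetBind]
    split_ifs with ha
    · simp only [ha, iff_true]
      rcases mem_params_target ha with ⟨b, hb, hab⟩ | ⟨j, hj, hab⟩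
      · rw [hab]
        exact (hq.bind_ne_none b).2 hb
      · rw [hab]
        simp [extend]
    · simp [ha]
  · dsimp only [HRGrammar.targetBind] at ha hb
    split_ifs at ha hb with ha' hb'
    have key : ∀ {c}, c ∈ params (Γ.target nm q.state ℓ) → ∀ j,
        (nm q.state ℓ).symm c = Sum.inr j → j ∈ {j | Sum.inr j ∈ ℓ.att} := by
      intro c hc j hj
      rcases mem_params_target hc with ⟨b, hb, hab⟩ | ⟨i, hi, hab⟩
      · rw [hj] at hab; cases hab
      · rw [hj] at hab; cases hab; exact hi
    exact (nm q.state ℓ).symm.injective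
      (extend_inj hq h2 (fun j hj => (h3 j hj).2) (key ha') (key hb') ha hb)

/-- Every parameter in the profile of the advanced item is a parameter of the target state, so its
value is that of the old parameter or new node it renames. The last clause is what later allows a
reduction to treat such nodes as new. -/
theorem HRGrammar.Read.advance_known {V : Set ℕ} {q q' : BState L} {it : Item L ℕ}
    (hit : it ∈ q.state) {B : Literal L ℕ} (hB : Γ.next it = some B) {e : Literal L ℕ}
    (h : Γ.Read nm V q (labelOf it.prof B) e q') :
    it.advance nm q.state B ∈ q'.state ∧
    (∀ x y, it.known q.bind x = some y → (it.advance nm q.state B).known q'.bind x = some y) ∧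
    Inst ((it.advance nm q.state B).known q'.bind) B e ∧
    (∀ x y, it.prof x = none → (it.advance nm q.state B).known q'.bind x = some y →
      y ∉ V) := by
  obtain ⟨h1, ν, h2, h3, h4, rfl⟩ := h
  have hmem := advance_mem_target (nm := nm) hit hB
  have key : ∀ x, (it.advance nm q.state B).known
      (Γ.targetBind nm q.state (labelOf it.prof B) q.bind ν) x =
      (profAfter it.prof B x).bind (extend q.bind ν) := by
    intro x
    rcases hx : profAfter it.prof B x with _ | s
    · simp [Item.known, Item.advance, Item.map, hx]
    · have hp : nm q.state (labelOf it.prof B) s ∈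
          params (Γ.target nm q.state (labelOf it.prof B)) :=
        ⟨_, hmem, x, by simp [Item.advance, Item.map, hx]⟩
      simp [Item.known, Item.advance, Item.map, hx, HRGrammar.targetBind, hp]
  refine ⟨hmem, ?_, ?_, ?_⟩
  · intro x y hxy
    dsimp only
    rw [key]
    simp only [Item.known, Option.bind_eq_some_iff] at hxy
    obtain ⟨a, ha, hay⟩ := hxy
    rw [profAfter_eq_inl.2 ha]
    exact hay
  · refine h4.of_map fun x hx => ?_
    dsimp only
    rw [key, profAfter_of_mem hx]
    rfl
  · intro x y hx hxy
    dsimp only at hxy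
    rw [key] at hxy
    obtain ⟨s, hs, hsy⟩ := Option.bind_eq_some_iff.1 hxy
    rcases s with a | j
    · rw [profAfter_eq_inl, hx] at hs
      cases hs
    · rw [profAfter_eq_inr] at hs
      have := (h3 j (inr_mem_labelOf.2 ⟨x, hs⟩)).1
      simp only [extend, Sum.elim_inr, Option.some.injEq] at hsy
      rwa [hsy] at this

/-- A label names a new node by its first position in `B`, so the node for `j` is the `ψ`-image of
the node at position `j`. The default 0 only fills irrelevant positions. -/
theorem exists_read {V : Set ℕ} {q : BState L} (hq : q.Proper Γ nm) {it : Item L ℕ}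
    (hit : it ∈ q.state) {B : Literal L ℕ} (hB : Γ.next it = some B) {e : Literal L ℕ}
    {ψ : ℕ → Option ℕ} (he : Inst ψ B e)
    (hold : ∀ x ∈ B.att, ∀ y, it.known q.bind x = some y → ψ x = some y)
    (hinj : ∀ x ∈ B.att, ∀ y ∈ B.att, ψ x = ψ y → x = y)
    (hnew : ∀ x ∈ B.att, it.known q.bind x = none → ∀ y, ψ x = some y →
      y ∉ V ∧ ∀ a, q.bind a ≠ some y) :
    ∃ q', Γ.Read nm V q (labelOf it.prof B) e q' := by
  have hν : ∀ u ∈ B.att, ∀ y, ψ u = some y → ((B.att[B.att.idxOf u]?).bind ψ).getD 0 = y := by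
    intro u hu y huy
    simp [List.getElem?_idxOf hu, huy]
  refine ⟨_, ⟨it, hit, B, hB, rfl⟩, fun j => ((B.att[j]?).bind ψ).getD 0, ?_, ?_, ?_, rfl⟩
  · intro i hi j hj hij
    obtain ⟨u, hu, hu', rfl⟩ := inr_mem_labelOf.1 hi
    obtain ⟨v, hv, hv', rfl⟩ := inr_mem_labelOf.1 hj
    obtain ⟨y, -, hy⟩ := he.exists_image hu
    obtain ⟨z, -, hz⟩ := he.exists_image hv
    dsimp only at hij
    rw [hν u hu y hy, hν v hv z hz] at hij
    rw [hinj u hu v hv (by rw [hy, hz, hij])]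
  · intro j hj
    obtain ⟨u, hu, hu', rfl⟩ := inr_mem_labelOf.1 hj
    obtain ⟨y, -, hy⟩ := he.exists_image hu
    dsimp only
    rw [hν u hu y hy]
    exact hnew u hu ((hq.known_eq_none hit).2 hu') y hy
  · refine he.congr _ fun x hx => ?_
    obtain ⟨y, -, hy⟩ := he.exists_image hx
    rcases hσ : it.prof x with _ | a
    · rw [paramOf_of_none hσ, hy]
      simp only [extend, Sum.elim_inr]
      rw [hν x hx y hy]
    · rw [paramOf_of_some hσ]
      simp only [extend, Sum.elim_inl]
      obtain ⟨z, hz⟩ := Option.ne_none_iff_exists'.1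
        ((hq.bind_ne_none a).2 ⟨it, hit, x, hσ⟩)
      rw [hz, hold x hx z (by simp [Item.known, hσ, hz])]

/-! ### Determinism of reading -/

theorem idxOf_map_of_injOn {α β : Type*} [BEq α] [LawfulBEq α] [BEq β] [LawfulBEq β]
    {f : α → β} {l : List α} {a : α} (h : ∀ x ∈ l, f x = f a → x = a) :
    (l.map f).idxOf (f a) = l.idxOf a := by
  induction l with
  | nil => rfl
  | cons b l ih =>
    rw [List.map_cons, List.idxOf_cons, List.idxOf_cons]
    by_cases hb : b = a
    · rw [hb, beq_self_eq_true, beq_self_eq_true]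
      rfl
    · have hb' : f b ≠ f a := fun h' => hb (h b List.mem_cons_self h')
      rw [ih fun x hx => h x (List.mem_cons_of_mem _ hx), beq_eq_false_iff_ne.2 hb,
        beq_eq_false_iff_ne.2 hb']

/-- The literal `e` encodes the label: a position carries an old parameter exactly if its node is
bound, the injective binding tells which one, and the name of a new node is the first position of
that node in `e`. -/
theorem HRGrammar.Read.label_eq {V V' : Set ℕ} {q q₁ q₂ : BState L} (hq : q.Proper Γ nm)
    {ℓ₁ ℓ₂ : Label L} {e : Literal L ℕ} (h₁ : Γ.Read nm V q ℓ₁ e q₁)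
    (h₂ : Γ.Read nm V' q ℓ₂ e q₂) : ℓ₁ = ℓ₂ := by
  have key : ∀ {V : Set ℕ} {q' : BState L} {ℓ : Label L}, Γ.Read nm V q ℓ e q' →
      ∀ j y, Sum.inr j ∈ ℓ.att → ∀ ν : ℕ → ℕ, Set.InjOn ν {j | Sum.inr j ∈ ℓ.att} →
      (∀ j, Sum.inr j ∈ ℓ.att → ν j ∉ V ∧ ∀ a, q.bind a ≠ some (ν j)) →
      Inst (extend q.bind ν) ℓ e → ν j = y → e.att.idxOf y = j := by
    rintro V q' ℓ ⟨⟨it, hit, B, hB, rfl⟩, -⟩ j y hj ν h2 h3 h4 rfl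
    obtain ⟨u, hu, hu', rfl⟩ := inr_mem_labelOf.1 hj
    rw [← idxOf_map_of_injOn (f := (some : ℕ → Option ℕ)) (fun x _ h => Option.some_injective _ h),
      ← h4.2]
    have h5 : some (ν (B.att.idxOf u)) = (extend q.bind ν ∘ paramOf it.prof B) u := by
      simp [paramOf_of_none hu', extend]
    rw [h5, labelOf, Literal.map, List.map_map, idxOf_map_of_injOn]
    intro x hx hxu
    refine profAfter_inj (hq.isState.proper it hit).inj (profAfter_of_mem hx) ?_
    rw [profAfter_of_mem hu]
    refine congrArg some (extend_inj hq h2 (fun j hj => (h3 j hj).2) ?_ ?_ h5.symm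
      (hxu.trans h5.symm))
    · intro i hi
      rw [Set.mem_ofPred_eq, ← hi]
      exact List.mem_map_of_mem hu
    · intro i hi
      rw [Set.mem_ofPred_eq, ← hi]
      exact List.mem_map_of_mem hx
  have k₁ := key h₁
  have k₂ := key h₂
  obtain ⟨-, ν₁, i₁, n₁, e₁, -⟩ := h₁
  obtain ⟨-, ν₂, i₂, n₂, e₂, -⟩ := h₂
  replace k₁ := fun j y hj => k₁ j y hj ν₁ i₁ n₁ e₁
  replace k₂ := fun j y hj => k₂ j y hj ν₂ i₂ n₂ e₂
  obtain ⟨l₁, a₁⟩ := ℓ₁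
  obtain ⟨l₂, a₂⟩ := ℓ₂
  have hl : l₁ = l₂ := e₁.1.symm.trans e₂.1
  suffices a₁ = a₂ by rw [hl, this]
  have ha : a₁.map (extend q.bind ν₁) = a₂.map (extend q.bind ν₂) := e₁.2.trans e₂.2.symm
  refine List.ext_getElem (by simpa using congrArg List.length ha) fun i hi₁ hi₂ => ?_
  have hm₁ : a₁[i] ∈ a₁ := List.getElem_mem hi₁
  have hm₂ : a₂[i] ∈ a₂ := List.getElem_mem hi₂
  have hi : extend q.bind ν₁ a₁[i] = extend q.bind ν₂ a₂[i] := by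
    have := congrArg (fun l => l[i]?) ha
    simpa [hi₁, hi₂] using this
  obtain ⟨y, -, hy⟩ := e₁.exists_image hm₁
  dsimp only at *
  rcases hs : a₁[i] with a | j <;> rcases ht : a₂[i] with b | k <;> rw [hs] at hm₁ hi hy <;>
    rw [ht] at hm₂ hi <;> simp only [extend, Sum.elim_inl, Sum.elim_inr] at hi hy
  · rw [hq.inj _ _ _ hy (hi ▸ hy)]
  · exact absurd hi ((n₂ k hm₂).2 a)
  · exact absurd hi.symm ((n₁ j hm₁).2 b)
  · rw [← k₁ j _ hm₁ rfl, ← k₂ k _ hm₂ rfl, Option.some_injective _ hi]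

/-- The target of a transition is determined by the literal that is read. -/
theorem HRGrammar.Read.det {V V' : Set ℕ} {q q₁ q₂ : BState L} (hq : q.Proper Γ nm)
    {ℓ₁ ℓ₂ : Label L} {e : Literal L ℕ} (h₁ : Γ.Read nm V q ℓ₁ e q₁)
    (h₂ : Γ.Read nm V' q ℓ₂ e q₂) : q₁ = q₂ := by
  obtain rfl := h₁.label_eq hq h₂
  obtain ⟨-, ν₁, -, -, e₁, rfl⟩ := h₁
  obtain ⟨-, ν₂, -, -, e₂, rfl⟩ := h₂
  have h := List.map_inj_left.1 (e₁.2.trans e₂.2.symm)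
  congr 1
  funext a
  unfold HRGrammar.targetBind
  split_ifs with ha
  · rcases mem_params_target ha with ⟨b, -, hb⟩ | ⟨j, hj, hb⟩
    · rw [hb]
      rfl
    · rw [hb, h _ hj]
  · rfl

/-! ### Invariants of configurations -/

theorem nodes_append (g h : Graph L) : nodes (g ++ h) = nodes g ∪ nodes h := by
  ext x
  simp only [nodes, List.mem_append, Set.mem_ofPred_eq, Set.mem_union]
  constructor
  · rintro ⟨e, he | he, hx⟩
    exacts [.inl ⟨e, he, hx⟩, .inr ⟨e, he, hx⟩]
  · rintro (⟨e, he, hx⟩ | ⟨e, he, hx⟩)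
    exacts [⟨e, .inl he, hx⟩, ⟨e, .inr he, hx⟩]

theorem mem_nodes_singleton {e : Literal L ℕ} {x : ℕ} : x ∈ nodes [e] ↔ x ∈ e.att := by
  simp [nodes]

theorem nodes_finite (g : Graph L) : (nodes g).Finite := by
  refine (g.flatMap Literal.att).finite_toSet.subset ?_
  rintro x ⟨e, he, hx⟩
  exact List.mem_flatMap.2 ⟨e, he, hx⟩

theorem stackGraph_append (S T : Stack L) : stackGraph (S ++ T) = stackGraph S ++ stackGraph T :=
  List.map_append

@[simp] theorem top_nil : Γ.top [] = Γ.initial := rfl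

@[simp] theorem top_concat (S : Stack L) (x : Literal L ℕ × BState L) :
    Γ.top (S ++ [x]) = x.2 := by simp [HRGrammar.top]

theorem top_append_congr {S T : Stack L} (h : Γ.top S = Γ.top T) (U : Stack L) :
    Γ.top (S ++ U) = Γ.top (T ++ U) := by
  rcases U.eq_nil_or_concat with rfl | ⟨U, x, rfl⟩
  · simpa using h
  · rw [List.concat_eq_append, ← List.append_assoc, ← List.append_assoc, top_concat, top_concat]

/-- Stacks along which each state results from reading a literal in the state below. -/
inductive HRGrammar.WellFormed (Γ : HRGrammar L) (nm : Naming L) : Stack L → Prop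
  | nil : Γ.WellFormed nm []
  | concat (S : Stack L) (ℓ : Label L) (e : Literal L ℕ) (q : BState L) :
      Γ.WellFormed nm S → Γ.Read nm (nodes (stackGraph S)) (Γ.top S) ℓ e q →
      Γ.WellFormed nm (S ++ [(e, q)])

theorem HRGrammar.WellFormed.of_prefix {S P : Stack L} (h : Γ.WellFormed nm S) (hP : P <+: S) :
    Γ.WellFormed nm P := by
  induction h with
  | nil => rw [List.prefix_nil.1 hP]; exact .nil
  | concat S ℓ e q hS hr ih =>
    rcases List.prefix_concat_iff.1 hP with rfl | hP
    · exact .concat S ℓ e q hS hr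
    · exact ih hP

theorem HRGrammar.WellFormed.proper {S : Stack L} (h : Γ.WellFormed nm S) :
    (Γ.top S).Proper Γ nm := by
  induction h with
  | nil => exact initial_proper
  | concat S ℓ e q hS hr ih => rw [top_concat]; exact hr.proper ih

theorem HRGrammar.WellFormed.mem_nodes {S : Stack L} (h : Γ.WellFormed nm S) {a y : ℕ}
    (hy : (Γ.top S).bind a = some y) : y ∈ nodes (stackGraph S) := by
  induction h generalizing a with
  | nil => simp [HRGrammar.initial] at hy
  | concat S ℓ e q hS hr ih =>
    rw [top_concat] at hy
    rw [stackGraph_append, nodes_append]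
    rcases hr.bind_mem hy with ⟨b, hb⟩ | hy
    · exact .inl (ih hb)
    · exact .inr (mem_nodes_singleton.2 hy)

/-- The invariant of reached configurations. -/
structure Config.Proper (Γ : HRGrammar L) (nm : Naming L) (c : Config L) : Prop where
  wf : Γ.WellFormed nm c.stack
  nodes_subset : nodes (stackGraph c.stack) ⊆ nodes c.graph

theorem Inst.mem_bind {σ : ℕ → Option ℕ} {τ : Binding} {B : Literal L ℕ} {e : Literal L ℕ}
    (h : Inst (fun x => (σ x).bind τ) B e) {y : ℕ} (hy : y ∈ e.att) : ∃ a, τ a = some y := by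
  obtain ⟨x, -, hx⟩ := h.exists_node hy
  obtain ⟨a, -, ha⟩ := Option.bind_eq_some_iff.1 hx
  exact ⟨a, ha⟩

/-- A reduction brings no new nodes onto the stack: those of the pushed literal are bound by the
topmost binding and hence occur on the old stack. -/
theorem Config.Proper.step {c c' : Config L} (h : c.Proper Γ nm) (hs : Γ.Step nm c c') :
    c'.Proper Γ nm := by
  obtain ⟨t, ht⟩ := hs
  obtain ⟨hwf, hsub⟩ := h
  cases ht with
  | shift S g ℓ e q' _ hr =>
    refine ⟨.concat S ℓ e q' hwf (hr.mono hsub), ?_⟩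
    rw [stackGraph_append, nodes_append, nodes_append]
    exact Set.union_subset_union_left _ hsub
  | reduce S S' g r σ ℓ A q' hit hh hA hr =>
    refine ⟨.concat S ℓ A q' (hwf.of_prefix (List.prefix_append _ _)) hr, ?_⟩
    dsimp only at hsub ⊢
    rw [stackGraph_append, nodes_append] at hsub ⊢
    refine Set.union_subset (Set.subset_union_left.trans hsub) fun y hy => ?_
    obtain ⟨a, ha⟩ := hA.mem_bind (mem_nodes_singleton.1 hy)
    have := hwf.mem_nodes ha
    rw [stackGraph_append, nodes_append] at this
    exact hsub this

theorem Config.Proper.steps {c c' : Config L} (h : c.Proper Γ nm)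
    (hs : Relation.ReflTransGen (Γ.Step nm) c c') : c'.Proper Γ nm := by
  induction hs with
  | refl => exact h
  | tail _ hs ih => exact ih.step hs

theorem HRGrammar.Reached.proper {c : Config L} (h : Γ.Reached nm c) : c.Proper Γ nm :=
  Config.Proper.steps ⟨.nil, by simp [HRGrammar.initConfig, stackGraph, nodes]⟩ h

/-! ### Productive literals -/

/-- Literals that derive a terminal graph. -/
inductive HRGrammar.Productive (Γ : HRGrammar L) : Literal L ℕ → Prop
  | terminal (B : Literal L ℕ) : B.lab ∈ Γ.terminal → Γ.Productive B
  | rule (r : Rule L) (ρ : ℕ → ℕ) : r ∈ Γ.rules → Function.Injective ρ →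
      (∀ e ∈ r.rhs, Γ.Productive e) → Γ.Productive (r.lhs.map ρ)

theorem exists_injective_extension (f : ℕ → ℕ) (s : List ℕ) (hf : Set.InjOn f {x | x ∈ s}) :
    ∃ g : ℕ → ℕ, Function.Injective g ∧ ∀ x ∈ s, g x = f x := by
  obtain ⟨M, hM⟩ : ∃ M, ∀ x ∈ s, f x < M := by
    refine ⟨(s.map f).sum + 1, fun x hx => Nat.lt_succ_of_le ?_⟩
    exact List.le_sum_of_mem (List.mem_map_of_mem hx)
  refine ⟨fun x => if x ∈ s then f x else M + x, fun x y hxy => ?_, fun x hx => if_pos hx⟩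
  dsimp only at hxy
  split_ifs at hxy with hx hy hy
  · exact hf hx hy hxy
  · have := hM x hx; omega
  · have := hM y hy; omega
  · omega

/-- Rule applications rename right-hand sides, so productivity must be pulled back along the match.
The required renaming, `ρ` followed by the inverse of `μ`, is meaningful only on the nodes of the
left-hand side and must be extended injectively. -/
theorem HRGrammar.Productive.of_map {B : Literal L ℕ} {μ : ℕ → ℕ} (hμ : Function.Injective μ)
    (h : Γ.Productive (B.map μ)) : Γ.Productive B := by
  generalize hB : B.map μ = B' at h
  cases h with
  | terminal _ h => subst hB; exact .terminal _ h
  | rule r ρ hr hρ hp =>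
    obtain ⟨l, a⟩ := B
    simp only [Literal.map, Literal.mk.injEq] at hB
    have hinv : ∀ x ∈ r.lhs.att, μ (Function.invFun μ (ρ x)) = ρ x := fun x hx => by
      have : ρ x ∈ a.map μ := hB.2 ▸ List.mem_map_of_mem hx
      obtain ⟨y, -, hy⟩ := List.mem_map.1 this
      exact Function.invFun_eq ⟨y, hy⟩
    obtain ⟨g, hg, hgx⟩ := exists_injective_extension (fun x => Function.invFun μ (ρ x)) r.lhs.att
      (fun x hx y hy hxy => hρ (by rw [← hinv x hx, ← hinv y hy]; exact congrArg μ hxy))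
    have : (⟨l, a⟩ : Literal L ℕ) = r.lhs.map g := by
      simp only [Literal.map, Literal.mk.injEq]
      refine ⟨hB.1, List.map_injective_iff.2 hμ ?_⟩
      rw [hB.2, List.map_map]
      refine List.map_congr_left fun x hx => ?_
      rw [Function.comp_apply, hgx x hx, hinv x hx]
    rw [this]
    exact .rule r g hr hg hp

theorem Rule.Apply.productive_of {r : Rule L} {g g' : Graph L} (h : r.Apply g g')
    (hg : ∀ e ∈ g', Γ.Productive e) : ∀ e ∈ r.rhs, Γ.Productive e := by
  obtain ⟨f, k, μ, hμ, rfl, rfl, -⟩ := h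
  intro e he
  refine .of_map hμ (hg _ ?_)
  simp only [List.mem_append, List.mem_map]
  exact .inl (.inr ⟨e, he, rfl⟩)

theorem productive_of_derives {g w : Graph L} (h : Relation.ReflTransGen Γ.Derives g w)
    (hw : ∀ e ∈ w, e.lab ∈ Γ.terminal) : ∀ e ∈ g, Γ.Productive e := by
  induction h using Relation.ReflTransGen.head_induction_on with
  | refl => exact fun e he => .terminal e (hw e he)
  | head h _ ih =>
    obtain ⟨r, hr, ha⟩ := h
    have hp := ha.productive_of ih
    obtain ⟨f, k, μ, hμ, rfl, rfl, -⟩ := ha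
    intro e he
    simp only [List.mem_append, List.mem_singleton] at he ih
    rcases he with (he | rfl) | he
    · exact ih e (.inl (.inl he))
    · exact .rule r μ hr hμ hp
    · exact ih e (.inr he)

/-- The bodies of all productions are productive, provided that there is some rule. -/
theorem HRGrammar.Reduced.productive (hred : Γ.Reduced) {r₀ : Rule L} (hr₀ : r₀ ∈ Γ.rules)
    {p : Option (Rule L)} (hp : ∀ r, p = some r → r ∈ Γ.rules) :
    ∀ B ∈ Γ.body p, Γ.Productive B := by
  rcases p with _ | r
  · obtain ⟨g, g', w, h1, h2, h3, h4⟩ := hred r₀ hr₀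
    exact productive_of_derives (h1.trans (.head ⟨r₀, hr₀, h2⟩ h3)) h4
  · obtain ⟨g, g', w, h1, h2, h3, h4⟩ := hred r (hp r rfl)
    exact h2.productive_of (productive_of_derives h3 h4)

/-! ### Items on a stack and their completion -/

/-- The item that is added for the rule `r` when the dot of `it` stands before its left-hand side,
renamed by `ρ`. -/
def Item.predict {P : Type*} (it : Item L P) (r : Rule L) (ρ : ℕ → ℕ) : Item L P :=
  ⟨some r, 0, fun v => if v ∈ r.lhs.att then it.prof (ρ v) else none⟩

theorem Item.map_predict {P P' : Type*} (f : P → P') (it : Item L P) (r : Rule L) (ρ : ℕ → ℕ) :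
    (it.predict r ρ).map f = (it.map f).predict r ρ := by
  simp only [Item.map, Item.predict, Item.mk.injEq, true_and]
  funext v
  split_ifs <;> rfl

/-- Items of the topmost state, traced back to the start item of the start state. -/
inductive HRGrammar.Traced (Γ : HRGrammar L) (nm : Naming L) : Stack L → Item L ℕ → Prop
  | start : Γ.Traced nm [] ⟨none, 0, fun _ => none⟩
  | advance (S : Stack L) (it : Item L ℕ) (B e : Literal L ℕ) (q : BState L) :
      Γ.Traced nm S it → it ∈ (Γ.top S).state → Γ.next it = some B →
      Γ.Read nm (nodes (stackGraph S)) (Γ.top S) (labelOf it.prof B) e q →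
      Γ.Traced nm (S ++ [(e, q)]) (it.advance nm (Γ.top S).state B)
  | predict (S : Stack L) (it : Item L ℕ) (r : Rule L) (ρ : ℕ → ℕ) :
      Γ.Traced nm S it → it ∈ (Γ.top S).state → r ∈ Γ.rules → Function.Injective ρ →
      Γ.next it = some (r.lhs.map ρ) → Γ.Traced nm S (it.predict r ρ)

theorem predict_mem {Q : State L} (hQ : Γ.IsState nm Q) {it : Item L ℕ} (hit : it ∈ Q)
    {r : Rule L} (hr : r ∈ Γ.rules) {ρ : ℕ → ℕ} (hρ : Function.Injective ρ)
    (hn : Γ.next it = some (r.lhs.map ρ)) : it.predict r ρ ∈ Q := by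
  cases hQ with
  | start => exact .predict it r ρ hit hr hρ hn
  | trans Q ℓ _ _ =>
    obtain ⟨it, hit, rfl⟩ := hit
    exact ⟨_, .predict it r ρ hit hr hρ hn, Item.map_predict _ it r ρ⟩

theorem HRGrammar.WellFormed.traced {S : Stack L} (h : Γ.WellFormed nm S) {it : Item L ℕ}
    (hit : it ∈ (Γ.top S).state) : Γ.Traced nm S it := by
  induction h generalizing it with
  | nil =>
    have hit' : Γ.Closure {⟨none, 0, fun _ => none⟩} it := hit
    induction hit' with
    | base it h => cases h; exact .start
    | predict it r ρ h hr hρ hn ih => exact .predict [] it r ρ (ih h) h hr hρ hn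
  | concat S ℓ e q hS hr ih =>
    rw [top_concat] at hit
    have hq : q.state = Γ.target nm (Γ.top S).state ℓ := by
      obtain ⟨-, ν, -, -, -, rfl⟩ := hr
      rfl
    dsimp only at hit
    rw [hq] at hit
    obtain ⟨it, hit, rfl⟩ := hit
    replace hit : Γ.Closure (Γ.kernel (Γ.top S).state ℓ) it := hit
    induction hit with
    | base it h =>
      obtain ⟨it, hit, B, hB, rfl, rfl⟩ := h
      exact .advance S it B e q (ih hit) hit hB hr
    | predict it r ρ h hr' hρ hn ih' =>
      have := Item.map_predict (nm (Γ.top S).state ℓ) it r ρ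
      rw [Item.predict] at this
      rw [this]
      refine .predict _ _ r ρ ih' ?_ hr' hρ hn
      rw [top_concat, hq]
      exact ⟨it, h, rfl⟩

/-- `W` completes the item `it` of the topmost state of `S` if `S ++ W` has a topmost state with a
corresponding reduce item such that `W` is an instance of the literals after the dot of `it`. -/
def HRGrammar.Completes (Γ : HRGrammar L) (S : Stack L) (it : Item L ℕ) (W : Stack L) : Prop :=
  ∃ σ : ℕ → Option ℕ, (⟨it.prod, (Γ.body it.prod).length, σ⟩ : Item L ℕ) ∈ (Γ.top (S ++ W)).state ∧
    (∀ x y, it.known (Γ.top S).bind x = some y → (σ x).bind (Γ.top (S ++ W)).bind = some y) ∧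
    List.Forall₂ (Inst fun x => (σ x).bind (Γ.top (S ++ W)).bind) ((Γ.body it.prod).drop it.dot)
      (stackGraph W) ∧
    ∀ x y, it.prof x = none → (σ x).bind (Γ.top (S ++ W)).bind = some y →
      y ∉ nodes (stackGraph S)

theorem completes_nil {S : Stack L} {it : Item L ℕ} (hit : it ∈ (Γ.top S).state)
    (hd : it.dot = (Γ.body it.prod).length) : Γ.Completes S it [] := by
  obtain ⟨p, d, σ⟩ := it
  dsimp only at hd
  subst hd
  refine ⟨σ, by simpa using hit, ?_, ?_, ?_⟩
  · simp [Item.known]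
  · simp [stackGraph]
  · intro x y hx
    dsimp only at hx
    simp [hx]

theorem completes_cons {S W : Stack L} (hS : (Γ.top S).Proper Γ nm) {it : Item L ℕ}
    (hit : it ∈ (Γ.top S).state) {B e : Literal L ℕ} {q : BState L} (hB : Γ.next it = some B)
    (hr : Γ.Read nm (nodes (stackGraph S)) (Γ.top S) (labelOf it.prof B) e q)
    (h : Γ.Completes (S ++ [(e, q)]) (it.advance nm (Γ.top S).state B) W) :
    Γ.Completes S it ((e, q) :: W) := by
  obtain ⟨hmem, hk, hi, hnew⟩ := hr.advance_known hit hB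
  obtain ⟨σ, h1, h2, h3, h4⟩ := h
  rw [top_concat] at h2
  rw [List.append_assoc, List.singleton_append] at h1 h2 h3 h4
  refine ⟨σ, h1, fun x y hxy => h2 x y (hk x y hxy), ?_, fun x y hx hxy => ?_⟩
  · have : (Γ.body it.prod).drop it.dot = B :: (Γ.body it.prod).drop (it.dot + 1) := by
      obtain ⟨h, hB⟩ := List.getElem?_eq_some_iff.1 hB
      rw [List.drop_eq_getElem_cons h, hB]
    rw [this]
    exact .cons (hi.mono h2) h3
  -- A node unknown at `S` becomes known either after `B`, and then `h4` keeps it off the larger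
  -- stack, or on reading `B`, and then it is a new node of that transition.
  · rcases hx' : (it.advance nm (Γ.top S).state B).prof x with _ | a
    · have := h4 x y hx' hxy
      rw [stackGraph_append, nodes_append] at this
      exact fun hy => this (.inl hy)
    · rcases hz : (it.advance nm (Γ.top S).state B).known q.bind x with _ | z
      · rw [(hr.proper hS).known_eq_none hmem, hx'] at hz
        cases hz
      · have := h2 x z hz
        rw [hxy] at this
        cases this
        exact hnew x _ hx hz

/-- `LhsKnown` makes the literal to be pushed defined. Its transition from `S` exists because
`Completes` records that known nodes keep their values and all others lie off `S`. The waiting item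
can thus move across the left-hand side. -/
theorem HRGrammar.Completes.exists_reduce {S W : Stack L} (hlhs : Γ.LhsKnown nm)
    (hwf : Γ.WellFormed nm (S ++ W)) {it : Item L ℕ} (hit : it ∈ (Γ.top S).state) {r : Rule L}
    {ρ : ℕ → ℕ} (hρ : Function.Injective ρ) (hn : Γ.next it = some (r.lhs.map ρ))
    (h : Γ.Completes S (it.predict r ρ) W) :
    ∃ A q, Γ.Read nm (nodes (stackGraph S)) (Γ.top S) (labelOf it.prof (r.lhs.map ρ)) A q ∧
      ∀ g, Γ.Step nm ⟨S ++ W, g⟩ ⟨S ++ [(A, q)], g⟩ := by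
  have hq := hwf.proper
  have hS := hwf.of_prefix (List.prefix_append S W)
  obtain ⟨σ, h1, h2, h3, h4⟩ := h
  obtain ⟨A, hA⟩ : ∃ A, Inst (fun x => (σ x).bind (Γ.top (S ++ W)).bind) r.lhs A :=
    exists_inst fun x hx => by
      have := hlhs _ hq.isState r σ h1 x hx
      rwa [Ne, ← hq.known_eq_none h1] at this
  -- The waiting item names the nodes of the left-hand side through `ρ`, so the assignment for
  -- `exists_read` has to undo `ρ`.
  have hA' := hA.congr (f' := fun u => (σ (Function.invFun ρ u)).bind (Γ.top (S ++ W)).bind) ρ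
    fun x _ => by rw [Function.leftInverse_invFun hρ x]
  have hmem : ∀ u ∈ (r.lhs.map ρ).att, ∃ v ∈ r.lhs.att, ρ v = u := fun u hu => by
    simpa [Literal.map] using hu
  obtain ⟨q, hr⟩ : ∃ q, Γ.Read nm (nodes (stackGraph S)) (Γ.top S)
      (labelOf it.prof (r.lhs.map ρ)) A q := by
    refine exists_read hS.proper hit hn hA' ?_ ?_ ?_
    · intro u hu y huy
      obtain ⟨v, hv, rfl⟩ := hmem u hu
      rw [Function.leftInverse_invFun hρ v]
      refine h2 v y ?_
      rw [← huy]
      simp [Item.known, Item.predict, hv]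
    · intro u hu u' hu' huu
      obtain ⟨v, hv, rfl⟩ := hmem u hu
      obtain ⟨v', hv', rfl⟩ := hmem u' hu'
      rw [Function.leftInverse_invFun hρ v, Function.leftInverse_invFun hρ v'] at huu
      obtain ⟨y, -, hy⟩ := hA.exists_image hv
      rw [hq.known_inj h1 hy (huu ▸ hy)]
    · intro u hu hun y huy
      obtain ⟨v, hv, rfl⟩ := hmem u hu
      rw [Function.leftInverse_invFun hρ v] at huy
      have := h4 v y (by simpa [Item.predict, hv] using (hS.proper.known_eq_none hit).1 hun) huy
      exact ⟨this, fun a ha => this (hS.mem_nodes ha)⟩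
  exact ⟨A, q, hr, fun g => ⟨_, .reduce S W g r σ _ A q h1 h3 hA hr⟩⟩

/-! ### Reading productive literals and reaching acceptance -/

/-- The parser can read, from each configuration with an item whose dot stands before `B`, some
instance of `B`. -/
def HRGrammar.Readable (Γ : HRGrammar L) (nm : Naming L) (B : Literal L ℕ) : Prop :=
  ∀ (S : Stack L) (g : Graph L) (it : Item L ℕ), (⟨S, g⟩ : Config L).Proper Γ nm →
    it ∈ (Γ.top S).state → Γ.next it = some B →
    ∃ e q v, Γ.Read nm (nodes (stackGraph S)) (Γ.top S) (labelOf it.prof B) e q ∧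
      Relation.ReflTransGen (Γ.Step nm) ⟨S, g⟩ ⟨S ++ [(e, q)], g ++ v⟩

theorem exists_completes {S : Stack L} {g : Graph L} {it : Item L ℕ}
    (hB : ∀ B ∈ (Γ.body it.prod).drop it.dot, Γ.Readable nm B)
    (hc : (⟨S, g⟩ : Config L).Proper Γ nm) (hit : it ∈ (Γ.top S).state) :
    ∃ W v, Γ.Completes S it W ∧
      Relation.ReflTransGen (Γ.Step nm) ⟨S, g⟩ ⟨S ++ W, g ++ v⟩ := by
  generalize hl : (Γ.body it.prod).drop it.dot = l at hB
  induction l generalizing S g it with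
  | nil =>
    refine ⟨[], [], completes_nil hit ?_, by simpa using Relation.ReflTransGen.refl⟩
    exact le_antisymm (hc.wf.proper.isState.proper it hit).dot_le (List.drop_eq_nil_iff.1 hl)
  | cons B l ih =>
    have hlt : it.dot < (Γ.body it.prod).length := by
      by_contra h
      rw [List.drop_eq_nil_of_le (not_lt.1 h)] at hl
      cases hl
    rw [List.drop_eq_getElem_cons hlt, List.cons.injEq] at hl
    have hn : Γ.next it = some B := by rw [HRGrammar.next, List.getElem?_eq_getElem hlt, hl.1]
    obtain ⟨e, q, v, hr, hs⟩ := hB B List.mem_cons_self S g it hc hit hn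
    obtain ⟨W, w, hW, hs'⟩ := ih (it := it.advance nm (Γ.top S).state B) (hc.steps hs)
      (by rw [top_concat]; exact (hr.advance_known hit hn).1) hl.2
      fun C hC => hB C (List.mem_cons_of_mem _ hC)
    refine ⟨(e, q) :: W, v ++ w, completes_cons hc.wf.proper hit hn hr hW, hs.trans ?_⟩
    simpa using hs'

/-- A terminal literal is shifted with fresh nodes. For a nonterminal one, the predicted item is
completed, using the induction hypothesis for the right-hand side, and then reduced. -/
theorem HRGrammar.Productive.readable (hlhs : Γ.LhsKnown nm) {B : Literal L ℕ}
    (h : Γ.Productive B) : Γ.Readable nm B := by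
  induction h with
  | terminal B hB =>
    intro S g it hc hit hn
    have hq := hc.wf.proper
    obtain ⟨M, hM⟩ := (nodes_finite g).bddAbove
    have hfresh : ∀ x, M + 1 + x ∉ nodes g := fun x hx => by
      have := hM hx
      omega
    -- `M` bounds all nodes read so far, so the values `M + 1 + x` for unknown nodes are new and
    -- pairwise distinct.
    obtain ⟨e, he⟩ : ∃ e, Inst (fun x => some ((it.known (Γ.top S).bind x).getD (M + 1 + x))) B e :=
      exists_inst (by simp)
    have hold : ∀ {x y}, it.known (Γ.top S).bind x = some y → y ∈ nodes g := by
      intro x y hxy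
      obtain ⟨a, -, ha⟩ := Option.bind_eq_some_iff.1 hxy
      exact hc.nodes_subset (hc.wf.mem_nodes ha)
    obtain ⟨q, hr⟩ := exists_read (V := nodes g) hq hit hn he
      (fun x _ y hxy => by simp [hxy])
      (fun x _ y _ hxy => by
        rw [Option.some.injEq] at hxy
        rcases hx : it.known (Γ.top S).bind x with _ | a <;>
          rcases hy : it.known (Γ.top S).bind y with _ | b <;>
          simp only [hx, hy, Option.getD_some, Option.getD_none] at hxy
        · omega
        · exact absurd (hold hy) (hxy ▸ hfresh x)
        · exact absurd (hold hx) (hxy ▸ hfresh y)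
        · exact hq.known_inj hit hx (hxy ▸ hy))
      (fun x _ hx y hxy => by
        rw [hx, Option.getD_none, Option.some.injEq] at hxy
        subst hxy
        exact ⟨hfresh x, fun a ha => hfresh x (hc.nodes_subset (hc.wf.mem_nodes ha))⟩)
    exact ⟨e, q, [e], hr.mono hc.nodes_subset,
      .single ⟨_, .shift S g _ e q (he.1 ▸ hB) hr⟩⟩
  | rule r ρ hr hρ _ ih =>
    intro S g it hc hit hn
    have hp := predict_mem hc.wf.proper.isState hit hr hρ hn
    obtain ⟨W, v, hW, hs⟩ := exists_completes (it := it.predict r ρ)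
      (fun B hB => ih B (List.mem_of_mem_drop hB)) hc hp
    obtain ⟨A, q, hA, hs'⟩ := hW.exists_reduce hlhs (hc.steps hs).wf hit hρ hn
    exact ⟨A, q, v, hA, hs.tail (hs' _)⟩

/-- A successful sequence of moves starts in the configuration `c`. -/
def HRGrammar.Completable (Γ : HRGrammar L) (nm : Naming L) (c : Config L) : Prop :=
  ∃ v SA, Relation.ReflTransGen (Γ.Step nm) c ⟨SA, c.graph ++ v⟩ ∧ Accepting (Γ.top SA).state

theorem HRGrammar.Completable.of_steps {c c' : Config L} {v : Graph L}
    (hv : c'.graph = c.graph ++ v) (hs : Relation.ReflTransGen (Γ.Step nm) c c')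
    (h : Γ.Completable nm c') : Γ.Completable nm c := by
  obtain ⟨w, SA, h1, h2⟩ := h
  rw [hv, List.append_assoc] at h1
  exact ⟨v ++ w, SA, hs.trans h1, h2⟩

/-- Completion is passed back along the trace. For an advanced item, the literal just crossed joins
`W`; for a predicted one, the handle is reduced and the rest of the waiting production is read. At
the start item, completion yields the accepting item. -/
theorem HRGrammar.Traced.completable (hlhs : Γ.LhsKnown nm)
    (hp : ∀ p : Option (Rule L), (∀ r, p = some r → r ∈ Γ.rules) →
      ∀ B ∈ Γ.body p, Γ.Productive B)
    {S : Stack L} {it : Item L ℕ} (h : Γ.Traced nm S it) {W : Stack L} {g : Graph L}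
    (hc : (⟨S ++ W, g⟩ : Config L).Proper Γ nm) (hW : Γ.Completes S it W) :
    Γ.Completable nm ⟨S ++ W, g⟩ := by
  induction h generalizing W g with
  | start =>
    obtain ⟨σ, h1, -⟩ := hW
    exact ⟨[], [] ++ W, by simpa using Relation.ReflTransGen.refl, _, h1, rfl, rfl⟩
  | advance S it B e q _ hit hn hr ih =>
    rw [List.append_assoc] at hc ⊢
    exact ih hc (completes_cons (hc.wf.of_prefix (List.prefix_append _ _)).proper hit hn hr hW)
  | predict S it r ρ _ hit hr hρ hn ih =>
    obtain ⟨A, q, hA, hs⟩ := hW.exists_reduce hlhs hc.wf hit hρ hn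
    have hc' := hc.step (hs g)
    have hit' := hc'.wf.proper
    have hmem : it.advance nm (Γ.top S).state (r.lhs.map ρ) ∈ (Γ.top (S ++ [(A, q)])).state := by
      rw [top_concat]
      exact (hA.advance_known hit hn).1
    obtain ⟨W', v, hW', hs'⟩ := exists_completes (fun B hB => (hp _
      (hit'.isState.proper _ hmem).mem_rules B (List.mem_of_mem_drop hB)).readable hlhs) hc' hmem
    have := ih (W := (A, q) :: W') (g := g ++ v) (by simpa using hc'.steps hs')
      (completes_cons (hc.wf.of_prefix (List.prefix_append _ _)).proper hit hn hA hW')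
    refine .of_steps (v := v) rfl (.head (hs g) hs') ?_
    simpa using this

/-- Every configuration with the invariant can be completed successfully. -/
theorem Config.Proper.completable (hlhs : Γ.LhsKnown nm)
    (hp : ∀ p : Option (Rule L), (∀ r, p = some r → r ∈ Γ.rules) →
      ∀ B ∈ Γ.body p, Γ.Productive B)
    {c : Config L} (hc : c.Proper Γ nm) {it : Item L ℕ} (hit : it ∈ (Γ.top c.stack).state) :
    Γ.Completable nm c := by
  obtain ⟨W, v, hW, hs⟩ := exists_completes (fun B hB => (hp _
    (hc.wf.proper.isState.proper _ hit).mem_rules B (List.mem_of_mem_drop hB)).readable hlhs)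
    hc hit
  exact .of_steps (v := v) rfl hs ((hc.wf.traced hit).completable hlhs hp (hc.steps hs) hW)

/-! ### Moves -/

theorem HRGrammar.Move.isTrigger {t : Trigger L} {c c' : Config L} (h : Γ.Move nm t c c') :
    Γ.IsTrigger (Γ.top c.stack).state t := by
  cases h with
  | shift S g ℓ e q' he hr =>
    obtain ⟨h1, ν, -, -, h4, -⟩ := hr
    exact .trans ℓ (h4.1 ▸ he) h1
  | reduce S S' g r σ ℓ A q' hit _ _ _ => exact .item _ hit rfl

theorem HRGrammar.Move.exists_reduce {t : Trigger L} {c c' : Config L} (h : Γ.Move nm t c c')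
    (hg : c'.graph.length = c.graph.length) :
    ∃ S S' r σ ℓ A q, c.stack = S ++ S' ∧ c' = ⟨S ++ [(A, q)], c.graph⟩ ∧
      t = .item ⟨some r, r.rhs.length, σ⟩ ∧
      (⟨some r, r.rhs.length, σ⟩ : Item L ℕ) ∈ (Γ.top c.stack).state ∧
      S'.length = r.rhs.length ∧
      Inst (fun x => (σ x).bind (Γ.top c.stack).bind) r.lhs A ∧
      Γ.Read nm (nodes (stackGraph S)) (Γ.top S) ℓ A q := by
  cases h with
  | shift S g ℓ e q' he hr => simp at hg
  | reduce S S' g r σ ℓ A q' hit hh hA hr =>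
    have := hh.length_eq
    rw [stackGraph, List.length_map] at this
    exact ⟨S, S', r, σ, ℓ, A, q', rfl, rfl, rfl, hit, this.symm, hA, hr⟩

theorem HRGrammar.Move.graph_eq_of_item {it : Item L ℕ} {c c' : Config L}
    (h : Γ.Move nm (.item it) c c') : c'.graph = c.graph := by
  cases h
  rfl

theorem HRGrammar.Step.exists_concat {c c' : Config L} (h : Γ.Step nm c c') :
    (c'.graph.length = c.graph.length + 1 ∧ ∃ x, c'.stack = c.stack ++ [x]) ∨
      (c'.graph.length = c.graph.length ∧ ∃ R x, R <+: c.stack ∧ c'.stack = R ++ [x]) := by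
  obtain ⟨t, h⟩ := h
  cases h with
  | shift S g ℓ e q' he hr => exact .inl ⟨by simp, _, rfl⟩
  | reduce S S' g r σ ℓ A q' hit hh hA hr =>
    exact .inr ⟨rfl, S, _, List.prefix_append _ _, rfl⟩

/-- A reduce move that leaves a part of the stack untouched behaves in the same way above another
stack with the same topmost state. -/
theorem HRGrammar.Move.det {P P' W W' : Stack L} {g g' : Graph L} {t : Trigger L} {d : Config L}
    (hwf : Γ.WellFormed nm (P ++ W)) (hP : Γ.top P' = Γ.top P)
    (h : Γ.Move nm t ⟨P ++ W, g⟩ ⟨P ++ W', g⟩) (hW' : W' ≠ [])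
    (h' : Γ.Move nm t ⟨P' ++ W, g'⟩ d) : d = ⟨P' ++ W', g'⟩ := by
  obtain ⟨S, S', r, σ, ℓ, A, q, hS, hc, rfl, hit, hl, hA, hr⟩ := h.exists_reduce rfl
  have hd : d.graph.length = g'.length := congrArg List.length h'.graph_eq_of_item
  obtain ⟨T, T', r₂, σ₂, ℓ₂, A₂, q₂, hT, rfl, ht, hit₂, hl₂, hA₂, hr₂⟩ := h'.exists_reduce hd
  simp only [Trigger.item.injEq, Item.mk.injEq, Option.some.injEq] at ht
  obtain ⟨rfl, -, rfl⟩ := ht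
  dsimp only at *
  obtain ⟨U, x, rfl⟩ := W'.eq_nil_or_concat.resolve_left hW'
  rw [List.concat_eq_append] at hc ⊢
  rw [Config.mk.injEq, ← List.append_assoc] at hc
  obtain ⟨rfl, hx⟩ := List.append_inj' hc.1 rfl
  rw [List.append_assoc] at hS
  have hW := List.append_cancel_left hS
  subst hW
  rw [← List.append_assoc] at hT
  obtain ⟨rfl, rfl⟩ := List.append_inj' hT (hl.trans hl₂.symm)
  rw [top_append_congr hP] at hA₂ hr₂
  obtain rfl := hA.det hA₂
  have hq := hr.det
    (hwf.of_prefix (by rw [← List.append_assoc]; exact List.prefix_append _ _)).proper hr₂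
  rw [hx, hq, List.append_assoc]

/-! ### Conflicts -/

/-- `Success` forgets the stack below its topmost element, so the two successes may come from
different stacks. The image of `First v` lies in `Follow` and `FollowStar` of both triggers, which
gives a cycle of length two. -/
theorem HRGrammar.ConflictFree.trigger_eq {q : BState L} (h : Γ.ConflictFree nm q.state)
    {t t' : Trigger L} (ht : Γ.IsTrigger q.state t) (ht' : Γ.IsTrigger q.state t')
    {g v : Graph L} (hv : v ∈ Γ.Success nm q g t) (hv' : v ∈ Γ.Success nm q g t') : t = t' := by
  by_contra hne
  have hany : First v ∈ Any v := by
    rcases v with _ | ⟨e, v⟩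
    · exact .inr ⟨rfl, rfl⟩
    · exact .inl ⟨e, List.mem_cons_self, rfl⟩
  have key : ∀ {s s' : Trigger L}, Γ.IsTrigger q.state s → Γ.IsTrigger q.state s' → s ≠ s' →
      v ∈ Γ.Success nm q g s → v ∈ Γ.Success nm q g s' → Γ.Precedes nm q.state s s' :=
    fun hs hs' hne hv hv' => ⟨hs, hs', hne, _, ⟨q.bind, g, v, hv, _, hany, rfl⟩,
      ⟨q.bind, g, v, hv', rfl⟩⟩
  refine h (Set.range ![t, t']) ?_ ⟨1, ![t, t'], rfl, ?_⟩
  · rintro _ ⟨i, rfl⟩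
    fin_cases i
    exacts [ht, ht']
  · intro i
    fin_cases i
    · exact key ht ht' hne hv hv'
    · exact key ht' ht (Ne.symm hne) hv' hv

/-- Without conflicts, the parser never performs a sequence of reduce moves that can be repeated
forever, since it can always leave such a loop and succeed. -/
theorem HRGrammar.ConflictFree.no_loop (hconf : ∀ Q ∈ Γ.states nm, Γ.ConflictFree nm Q)
    {P Y : Stack L} {W : ℕ → Stack L} {g : Graph L} {p : ℕ} (hp : 0 < p)
    (h0 : Γ.Reached nm ⟨P ++ W 0, g⟩)
    (hs : ∀ k < p, Γ.Step nm ⟨P ++ W k, g⟩ ⟨P ++ W (k + 1), g⟩) (hW : ∀ k < p, W (k + 1) ≠ [])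
    (hY : W p = Y ++ W 0) (hP : Γ.top (P ++ Y) = Γ.top P)
    (hc : Γ.Completable nm ⟨P ++ W p, g⟩) : False := by
  obtain ⟨v, SA, hv, hA⟩ := hc
  have hreach : ∀ k ≤ p, Γ.Reached nm ⟨P ++ W k, g⟩ := by
    intro k
    induction k with
    | zero => exact fun _ => h0
    | succ k ih => exact fun hk => (ih (by omega)).tail (hs k hk)
  have hrest : ∀ k ≤ p, Relation.ReflTransGen (Γ.Step nm) ⟨P ++ W k, g⟩ ⟨P ++ W p, g⟩ := by
    intro k hk
    induction hk using Nat.decreasingInduction with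
    | self => exact .refl
    | of_succ k hk ih => exact .head (hs k hk) ih
  have hend : ∀ {P' : Stack L}, Γ.top P' = Γ.top P → Γ.top (P' ++ Y) = Γ.top P := by
    intro P' hP'
    rw [← hP]
    exact top_append_congr hP' Y
  dsimp only at hv
  -- Invariant along the successful sequence: it is at phase `k` of the loop, above some `P'` that
  -- agrees with `P` in its topmost state and binding.
  suffices key : ∀ cur, Relation.ReflTransGen (Γ.Step nm) cur ⟨SA, g ++ v⟩ →
      Relation.ReflTransGen (Γ.Step nm) ⟨P ++ W p, g⟩ cur →
      (∃ k < p, ∃ P', cur = ⟨P' ++ W k, g⟩ ∧ Γ.top P' = Γ.top P) → False from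
    key _ hv .refl ⟨0, hp, P ++ Y, by rw [hY, List.append_assoc], hP⟩
  intro cur hcur
  induction hcur using Relation.ReflTransGen.head_induction_on with
  | refl =>
    rintro hto ⟨k, hk, P', hcur, hP'⟩
    rw [Config.mk.injEq] at hcur
    obtain ⟨rfl, hg⟩ := hcur
    obtain rfl := List.append_right_eq_self.1 hg
    obtain ⟨t, ht⟩ := hs k hk
    rw [top_append_congr hP'] at hA
    obtain ⟨it, hit, hacc⟩ := hA
    -- Acceptance inside the loop is impossible: on the empty graph, the accepting item and the
    -- reduce item of the loop would both succeed.
    have := (hconf _ (hreach k hk.le).proper.wf.proper.isState).trigger_eq (v := []) (g := g)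
      ht.isTrigger (.item it hit (by rw [hacc.1, hacc.2]; rfl))
      ⟨_, rfl, hreach k hk.le, .inl ⟨_, _, ht, (hrest (k + 1) hk).trans hto,
        by rw [top_append_congr hP']; exact ⟨it, hit, hacc⟩⟩⟩
      ⟨_, rfl, hreach k hk.le, .inr ⟨it, hit, hacc, rfl, rfl⟩⟩
    obtain ⟨_, _, r, σ, _, _, _, _, _, rfl, -⟩ := ht.exists_reduce rfl
    cases this
    cases hacc.1
  | @head cur next hstep hfin ih =>
    rintro hto ⟨k, hk, P', rfl, hP'⟩
    obtain ⟨t, ht⟩ := hs k hk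
    obtain ⟨t', ht'⟩ := hstep
    have htop : Γ.top (P' ++ W k) = Γ.top (P ++ W k) := top_append_congr hP' _
    have hr := (hreach p le_rfl).trans hto
    -- `t'` succeeds by the given sequence; `t` succeeds by finishing the loop, following the
    -- sequence up to `cur`, and then continuing to its end. Both process the same `v`.
    have htt : t' = t := by
      have hi := ht'.isTrigger
      dsimp only at hi
      rw [htop] at hi
      exact (hconf _ (hreach k hk.le).proper.wf.proper.isState).trigger_eq (v := v) (g := g)
        hi ht.isTrigger
        ⟨_, htop, hr, .inl ⟨_, _, ht', hfin, hA⟩⟩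
        ⟨_, rfl, hreach k hk.le, .inl ⟨_, _, ht,
          (hrest (k + 1) hk).trans (hto.trans (.head ⟨t', ht'⟩ hfin)), hA⟩⟩
    subst htt
    have hnext := ht.det (hreach k hk.le).proper.wf hP' (hW k hk) ht'
    refine ih (hto.tail ⟨_, ht'⟩) ?_
    rcases Nat.lt_or_ge (k + 1) p with hk' | hk'
    · exact ⟨k + 1, hk', P', hnext, hP'⟩
    · obtain rfl : p = k + 1 := by omega
      -- A round is finished: `Y` joins the untouched part and the next round begins.
      refine ⟨0, hp, P' ++ Y, ?_, hend hP'⟩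
      rw [hnext, hY, List.append_assoc]

/-! ### Sequences of reduce moves -/

/-- A sequence of reduce moves from a reached configuration. -/
structure ReduceRun (Γ : HRGrammar L) (nm : Naming L) (m : ℕ) (C : ℕ → Config L) : Prop where
  reached : Γ.Reached nm (C 0)
  step : ∀ i < m, Γ.Step nm (C i) (C (i + 1))
  length_eq : ∀ i < m, (C (i + 1)).graph.length = (C i).graph.length

theorem HRGrammar.IsState.nonempty {Q : State L} (h : Γ.IsState nm Q) : Q.Nonempty := by
  cases h with
  | start => exact ⟨_, .base _ rfl⟩
  | trans Q ℓ _ h =>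
    obtain ⟨it, hit, B, hB, rfl⟩ := h
    exact ⟨_, advance_mem_target hit hB⟩

namespace ReduceRun

variable {m : ℕ} {C : ℕ → Config L}

theorem reached_of_le (h : ReduceRun Γ nm m C) {i : ℕ} (hi : i ≤ m) : Γ.Reached nm (C i) := by
  induction i with
  | zero => exact h.reached
  | succ i ih => exact (ih (by omega)).tail (h.step i hi)

theorem exists_concat (h : ReduceRun Γ nm m C) {i : ℕ} (hi : i < m) :
    ∃ R x, R <+: (C i).stack ∧ (C (i + 1)).stack = R ++ [x] := by
  rcases (h.step i hi).exists_concat with ⟨h1, -⟩ | ⟨-, h2⟩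
  · have := h.length_eq i hi
    omega
  · exact h2

theorem graph_eq (h : ReduceRun Γ nm m C) {i : ℕ} (hi : i ≤ m) : (C i).graph = (C 0).graph := by
  induction i with
  | zero => rfl
  | succ i ih =>
    obtain ⟨t, ht⟩ := h.step i hi
    obtain ⟨_, _, _, _, _, _, _, -, hc, -⟩ := ht.exists_reduce (h.length_eq i hi)
    rw [hc, ih (by omega)]

theorem completable (h : ReduceRun Γ nm m C) (hred : Γ.Reduced) (hlhs : Γ.LhsKnown nm)
    {i : ℕ} (hm : 0 < m) (hi : i ≤ m) : Γ.Completable nm (C i) := by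
  -- The first reduce move supplies a rule; without one, reducedness would say nothing about the
  -- start literal.
  obtain ⟨t, ht⟩ := h.step 0 hm
  obtain ⟨_, _, r, σ, _, _, _, -, -, -, hit, -⟩ := ht.exists_reduce (h.length_eq 0 hm)
  have hr := (h.reached.proper.wf.proper.isState.proper _ hit).mem_rules r rfl
  have hc := (h.reached_of_le hi).proper
  obtain ⟨it, hit⟩ := hc.wf.proper.isState.nonempty
  exact hc.completable hlhs (fun p hp => hred.productive hr hp) hit

theorem eq_mk (h : ReduceRun Γ nm m C) {i : ℕ} (hi : i ≤ m) :
    C i = ⟨(C i).stack, (C 0).graph⟩ := by rw [← h.graph_eq hi]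

theorem stack_ne (h : ReduceRun Γ nm m C) (hred : Γ.Reduced) (hlhs : Γ.LhsKnown nm)
    (hconf : ∀ Q ∈ Γ.states nm, Γ.ConflictFree nm Q) {i j : ℕ} (hij : i < j) (hj : j ≤ m) :
    (C i).stack ≠ (C j).stack := by
  intro heq
  have hk : i + (j - i) = j := by omega
  refine HRGrammar.ConflictFree.no_loop hconf (P := []) (Y := []) (p := j - i)
    (W := fun k => (C (i + k)).stack) (g := (C 0).graph) (by omega) ?_ ?_ ?_ ?_ rfl ?_
  · have := h.reached_of_le (hij.le.trans hj)
    rwa [h.eq_mk (hij.le.trans hj)] at this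
  · intro k hk
    have := h.step (i + k) (by omega)
    rw [h.eq_mk (i := i + k) (by omega), h.eq_mk (i := i + k + 1) (by omega)] at this
    exact this
  · intro k hk
    obtain ⟨R, x, -, hR⟩ := h.exists_concat (i := i + k) (by omega)
    rw [← Nat.add_assoc, hR]
    simp
  · simp [hk, heq]
  · have := h.completable hred hlhs (by omega) hj
    rw [h.eq_mk hj] at this
    simpa [hk] using this

/-- The stack at time `i` is the untouched part of a loop that starts with nothing above it; what
lies above it at time `j` is the part added in each round. -/
theorem top_ne (h : ReduceRun Γ nm m C) (hred : Γ.Reduced) (hlhs : Γ.LhsKnown nm)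
    (hconf : ∀ Q ∈ Γ.states nm, Γ.ConflictFree nm Q) {i j : ℕ} (hij : i < j) (hj : j ≤ m)
    (hpre : ∀ k, i ≤ k → k ≤ j → (C i).stack <+: (C k).stack) :
    Γ.top (C i).stack ≠ Γ.top (C j).stack := by
  intro heq
  set W : ℕ → Stack L := fun k => (C (i + k)).stack.drop (C i).stack.length with hWdef
  have hW : ∀ k ≤ j - i, (C (i + k)).stack = (C i).stack ++ W k := by
    intro k hk
    obtain ⟨U, hU⟩ := hpre (i + k) (by omega) (by omega)
    simp only [hWdef]
    rw [← hU, List.drop_left]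
  have hk : i + (j - i) = j := by omega
  have hWj := hW (j - i) le_rfl
  rw [hk] at hWj
  have hmk : ∀ k ≤ j - i, C (i + k) = ⟨(C i).stack ++ W k, (C 0).graph⟩ := by
    intro k hk
    rw [← hW k hk]
    exact h.eq_mk (by omega)
  refine HRGrammar.ConflictFree.no_loop hconf (P := (C i).stack) (Y := W (j - i)) (p := j - i)
    (W := W) (g := (C 0).graph) (by omega) ?_ ?_ ?_ ?_ ?_ ?_
  · rw [← hmk 0 (by omega)]
    exact h.reached_of_le (by omega)
  · intro k hk
    rw [← hmk k (by omega), ← hmk (k + 1) (by omega)]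
    exact h.step (i + k) (by omega)
  -- An empty `W (k + 1)` would make the stack of time `i` recur.
  · intro k hk hnil
    have := hW (k + 1) (by omega)
    rw [hnil, List.append_nil] at this
    exact h.stack_ne hred hlhs hconf (i := i) (j := i + (k + 1)) (by omega) (by omega) this.symm
  · simp [hWdef]
  · rw [← hWj, heq]
  · rw [← hmk _ le_rfl, hk]
    exact h.completable hred hlhs (by omega) hj

/-- A reduction pushes just one literal, so a prefix at least as high as the initial stack was once
the entire stack. The last such time is followed only by moves above it. -/
theorem exists_permanent (h : ReduceRun Γ nm m C) {k : ℕ} (hk : k ≤ m) {P : Stack L}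
    (hP : P <+: (C k).stack) (hlen : (C 0).stack.length ≤ P.length) :
    ∃ i ≤ k, (C i).stack = P ∧ ∀ l, i ≤ l → l ≤ k → P <+: (C l).stack := by
  induction k with
  | zero =>
    have := hP.eq_of_length_le hlen
    exact ⟨0, le_rfl, this.symm, fun l _ hl => by rwa [Nat.le_zero.1 hl]⟩
  | succ k ih =>
    obtain ⟨R, x, hR, hk'⟩ := h.exists_concat (i := k) hk
    rw [hk'] at hP
    rcases List.prefix_concat_iff.1 hP with rfl | hPR
    · refine ⟨k + 1, le_rfl, hk', fun l hl hl' => ?_⟩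
      rw [le_antisymm hl' hl, hk']
    · obtain ⟨i, hi, hi', hpre⟩ := ih (by omega) (hPR.trans hR)
      refine ⟨i, by omega, hi', fun l hl hl' => ?_⟩
      rcases Nat.lt_or_ge k l with hkl | hkl
      · obtain rfl : l = k + 1 := by omega
        rw [hk']
        exact hP
      · exact hpre l hl hkl

theorem top_take_ne (h : ReduceRun Γ nm m C) (hred : Γ.Reduced) (hlhs : Γ.LhsKnown nm)
    (hconf : ∀ Q ∈ Γ.states nm, Γ.ConflictFree nm Q) {k : ℕ} (hk : k ≤ m) {P P' : Stack L}
    (hP' : P' <+: (C k).stack) (hP : P <+: P') (hlt : P.length < P'.length)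
    (hlen : (C 0).stack.length ≤ P.length) : Γ.top P ≠ Γ.top P' := by
  obtain ⟨i, hi, rfl, hpre⟩ := h.exists_permanent hk (hP.trans hP') hlen
  obtain ⟨j, hj, rfl, hpre'⟩ := h.exists_permanent hk hP' (hlen.trans hlt.le)
  have hij : i < j := by
    by_contra hji
    have := (hpre' i (not_lt.1 hji) hi).length_le
    omega
  exact h.top_ne hred hlhs hconf hij (hj.trans hk) fun l hl hl' => hpre l hl (hl'.trans hj)

theorem nodup_drop (h : ReduceRun Γ nm m C) (hred : Γ.Reduced) (hlhs : Γ.LhsKnown nm)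
    (hconf : ∀ Q ∈ Γ.states nm, Γ.ConflictFree nm Q) {k : ℕ} (hk : k ≤ m) :
    (((C k).stack.drop ((C 0).stack.length - 1)).map Prod.snd).Nodup := by
  rw [List.Nodup, List.pairwise_iff_getElem]
  intro i j hi hj hij
  simp only [List.length_map, List.length_drop] at hi hj
  simp only [List.getElem_map, List.getElem_drop]
  have htop : ∀ n (hn : n < (C k).stack.length),
      Γ.top ((C k).stack.take (n + 1)) = ((C k).stack[n]).2 := by
    intro n hn
    rw [List.take_succ_eq_append_getElem hn, top_concat]
  rw [← htop, ← htop]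
  refine h.top_take_ne hred hlhs hconf hk (List.take_prefix _ _)
    (List.take_prefix_take_left (by omega)) ?_ ?_ <;> simp only [List.length_take] <;> omega

end ReduceRun

/-! ### The number of reduce moves -/

theorem HRGrammar.WellFormed.exists_read {S : Stack L} {e : Literal L ℕ} {q : BState L}
    (h : Γ.WellFormed nm (S ++ [(e, q)])) :
    ∃ ℓ, Γ.Read nm (nodes (stackGraph S)) (Γ.top S) ℓ e q := by
  generalize hT : S ++ [(e, q)] = T at h
  cases h with
  | nil => simp at hT
  | concat S' ℓ e' q' hS hr =>
    obtain ⟨rfl, h2⟩ := List.append_inj' hT rfl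
    simp only [List.cons.injEq, Prod.mk.injEq, and_true] at h2
    obtain ⟨rfl, rfl⟩ := h2
    exact ⟨ℓ, hr⟩

/-- A state with its binding determines the literal below it on the stack. -/
theorem HRGrammar.Read.literal_eq {V V' : Set ℕ} {p p' q : BState L} {ℓ ℓ' : Label L}
    {e e' : Literal L ℕ} (h : Γ.Read nm V p ℓ e q) (h' : Γ.Read nm V' p' ℓ' e' q) : e = e' := by
  obtain ⟨it, hit, B, hB, rfl⟩ := h.1
  obtain ⟨hmem, -, hi, -⟩ := h.advance_known hit hB
  have hq : q.state = Γ.target nm p'.state ℓ' := by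
    obtain ⟨-, ν, -, -, -, rfl⟩ := h'
    rfl
  rw [hq] at hmem
  obtain ⟨it₀, hit₀, heq⟩ := hmem
  have hdot : it₀.dot ≠ 0 := by
    have : it₀.dot = it.dot + 1 := congrArg Item.dot heq
    omega
  obtain ⟨it', hit', B', hB', rfl, rfl⟩ := HRGrammar.Closure.mem_of_dot_ne_zero hit₀ hdot
  replace heq : it'.advance nm p'.state B' = it.advance nm p.state B := heq
  obtain ⟨-, -, hi', -⟩ := h'.advance_known hit' hB'
  have h1 : it'.prod = it.prod := (congrArg Item.prod heq :)
  have h2 : it'.dot + 1 = it.dot + 1 := (congrArg Item.dot heq :)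
  have hBB : B' = B := by
    rw [HRGrammar.next, h1, Nat.succ.inj h2] at hB'
    exact Option.some.inj (hB'.symm.trans hB)
  rw [heq, hBB] at hi'
  exact hi.det hi'

/-! ### Finitely many stacks up to an encoding of nodes -/

/-- The nodes bound by a binding. -/
def bound (τ : Binding) : Set ℕ := {y | ∃ a, τ a = some y}

theorem BState.Proper.bound_subset {q : BState L} (hq : q.Proper Γ nm) {A : Set ℕ}
    (hA : params q.state ⊆ A) : bound q.bind ⊆ (fun a => (q.bind a).getD 0) '' A := by
  rintro y ⟨a, ha⟩
  exact ⟨a, hA ((hq.bind_ne_none a).1 (by simp [ha])), by simp [ha]⟩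

/-- The spare element of `Fin (K + 1)` provides a default value outside `V`, even if `K = 0`. -/
theorem exists_injOn_fin {V : Set ℕ} (hV : V.Finite) {K : ℕ} (hK : V.ncard ≤ K) :
    ∃ f : ℕ → Fin (K + 1), Set.InjOn f V := by
  have : Finite V := hV
  obtain ⟨g⟩ : Nonempty (V ↪ Fin (K + 1)) := by
    have := Fintype.ofFinite V
    refine Function.Embedding.nonempty_of_card_le ?_
    rw [Fintype.card_fin, ← Nat.card_eq_fintype_card, Nat.card_coe_set_eq]
    omega
  classical
  refine ⟨fun x => if h : x ∈ V then g ⟨x, h⟩ else 0, fun x hx y hy hxy => ?_⟩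
  simp only [hx, hy, dif_pos] at hxy
  simpa using g.injective hxy

theorem finite_nodup_lists {α : Type*} {F : Set α} (hF : F.Finite) :
    {l : List α | l.Nodup ∧ ∀ x ∈ l, x ∈ F}.Finite := by
  classical
  have := hF.fintype
  have hfin : {l : List F | l.Nodup}.Finite :=
    Finite.of_fintype {l : List F // l.Nodup}
  refine (hfin.image (List.map Subtype.val)).subset ?_
  rintro l ⟨hl, hl'⟩
  lift l to List F using hl'
  exact ⟨l, List.Nodup.of_map _ hl, rfl⟩

theorem map_injOn {α β : Type*} {f : α → β} {E : Set α} (hf : Set.InjOn f E) {l l' : List α}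
    (hl : ∀ x ∈ l, x ∈ E) (hl' : ∀ x ∈ l', x ∈ E) (h : l.map f = l'.map f) : l = l' := by
  induction l generalizing l' with
  | nil => exact (List.map_eq_nil_iff.1 h.symm).symm
  | cons a l ih =>
    rcases l' with _ | ⟨b, l'⟩
    · cases h
    · rw [List.map_cons, List.map_cons, List.cons.injEq] at h
      rw [hf (hl a List.mem_cons_self) (hl' b List.mem_cons_self) h.1,
        ih (fun x hx => hl x (List.mem_cons_of_mem _ hx))
          (fun x hx => hl' x (List.mem_cons_of_mem _ hx)) h.2]

theorem exists_prefix_of_mem_drop {α : Type*} {l : List α} {d : ℕ} {x : α} (h : x ∈ l.drop d) :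
    ∃ P, P ++ [x] <+: l ∧ d ≤ P.length := by
  obtain ⟨i, hi, rfl⟩ := List.getElem_of_mem h
  rw [List.length_drop] at hi
  refine ⟨l.take (d + i), ?_, ?_⟩
  · rw [List.getElem_drop, ← List.take_succ_eq_append_getElem]
    exact List.take_prefix _ _
  · rw [List.length_take]
    omega

/-- A state with its binding, where the nodes are encoded by `f`. -/
def BState.encode {β : Type*} (f : ℕ → β) (q : BState L) : State L × (ℕ → Option β) :=
  (q.state, fun a => (q.bind a).map f)

theorem BState.encode_injOn {β : Type*} {f : ℕ → β} {V : Set ℕ} (hf : Set.InjOn f V) :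
    Set.InjOn (BState.encode (L := L) f) {q | bound q.bind ⊆ V} := by
  rintro ⟨Q, τ⟩ h ⟨Q', τ'⟩ h' heq
  simp only [BState.encode, Prod.mk.injEq] at heq
  obtain ⟨rfl, heq⟩ := heq
  congr 1
  funext a
  have ha := congrFun heq a
  rcases h1 : τ a with _ | y <;> rcases h2 : τ' a with _ | z <;> rw [h1, h2] at ha
  · cases ha
  · cases ha
  · simp only [Option.map_some, Option.some.injEq] at ha
    rw [hf (h ⟨a, h1⟩) (h' ⟨a, h2⟩) ha]

theorem finite_functions {β : Type*} [Finite β] {A : Set ℕ} (hA : A.Finite) :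
    {c : ℕ → Option β | ∀ a ∉ A, c a = none}.Finite := by
  have := hA.to_subtype
  refine Set.Finite.of_finite_image (f := fun c (a : A) => c a) (Set.toFinite _) ?_
  intro c hc d hd hcd
  funext a
  by_cases ha : a ∈ A
  · exact congrFun hcd ⟨a, ha⟩
  · rw [hc a ha, hd a ha]

namespace ReduceRun

variable {m : ℕ} {C : ℕ → Config L}

/-- A reduction gets its nodes from the topmost binding and from the one it uncovers. Since the
height never falls below the initial one, at most the topmost initial element is removed before a
push, so the one below it is the lowest that can matter. -/
theorem bound_subset (h : ReduceRun Γ nm m C)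
    (hlen : ∀ k ≤ m, (C 0).stack.length ≤ (C k).stack.length) {k : ℕ} (hk : k ≤ m) {P : Stack L}
    (hP : P <+: (C k).stack) (hd : (C 0).stack.length - 1 ≤ P.length) :
    bound (Γ.top P).bind ⊆
      bound (Γ.top (C 0).stack.dropLast).bind ∪ bound (Γ.top (C 0).stack).bind := by
  induction k generalizing P with
  | zero =>
    rcases (C 0).stack.eq_nil_or_concat with hS | ⟨S, x, hS⟩
    · rw [hS, List.prefix_nil] at hP
      rw [hP, hS]
      exact Set.subset_union_right
    · rw [List.concat_eq_append] at hS
      rw [hS] at hP hd ⊢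
      rcases List.prefix_concat_iff.1 hP with rfl | hP
      · exact Set.subset_union_right
      · rw [hP.eq_of_length_le (by simpa using hd), List.dropLast_concat]
        exact Set.subset_union_left
  | succ k ih =>
    obtain ⟨t, ht⟩ := h.step k hk
    obtain ⟨S, S', r, σ, ℓ, A, q, hS, hc, -, -, -, hA, hr⟩ := ht.exists_reduce (h.length_eq k hk)
    have hSk : S <+: (C k).stack := hS ▸ List.prefix_append _ _
    have hl := hlen _ hk
    rw [hc] at hP hl
    rcases List.prefix_concat_iff.1 hP with rfl | hP
    · rw [top_concat]
      rintro y ⟨a, ha⟩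
      rcases hr.bind_mem ha with hb | hy
      · refine ih (by omega) hSk ?_ hb
        simp only [List.length_append, List.length_singleton] at hl
        omega
      · refine ih (by omega) (List.prefix_refl _) ?_ (hA.mem_bind hy)
        have := hlen k (by omega)
        omega
    · exact ih (by omega) (hP.trans hSk) hd

theorem take_eq (h : ReduceRun Γ nm m C)
    (hlen : ∀ k ≤ m, (C 0).stack.length ≤ (C k).stack.length) {k : ℕ} (hk : k ≤ m) :
    (C k).stack.take ((C 0).stack.length - 1) = (C 0).stack.take ((C 0).stack.length - 1) := by
  induction k with
  | zero => rfl
  | succ k ih =>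
    rw [← ih (by omega)]
    obtain ⟨R, x, ⟨U, hU⟩, hR⟩ := h.exists_concat hk
    have hl := hlen _ hk
    rw [hR, List.length_append, List.length_singleton] at hl
    rw [hR, ← hU, List.take_append_of_le_length (by omega),
      List.take_append_of_le_length (by omega)]

end ReduceRun

/-- Without conflicts, the lengths of sequences of reduce moves that never make the stack smaller
than it was initially are bounded. -/
theorem exists_reduceRun_bound (hred : Γ.Reduced) (hfin : (Γ.states nm).Finite)
    (hlhs : Γ.LhsKnown nm) (hconf : ∀ Q ∈ Γ.states nm, Γ.ConflictFree nm Q) :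
    ∃ c : ℕ, ∀ (m : ℕ) (C : ℕ → Config L), ReduceRun Γ nm m C →
      (∀ k ≤ m, (C 0).stack.length ≤ (C k).stack.length) → m < c := by
  set A : Set ℕ := ⋃ Q ∈ Γ.states nm, params Q with hAdef
  have hA : A.Finite := hfin.biUnion fun Q hQ => HRGrammar.IsState.finite_params hQ
  have hpA : ∀ Q, Γ.IsState nm Q → params Q ⊆ A := fun Q hQ =>
    Set.subset_biUnion_of_mem (u := fun Q => params Q) (show Q ∈ Γ.states nm from hQ)
  -- `V` below consists of the nodes of two bindings, each defined on parameters from `A`; hence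
  -- this bound does not depend on the configuration.
  set K := A.ncard + A.ncard
  set F : Set (State L × (ℕ → Option (Fin (K + 1)))) :=
    Γ.states nm ×ˢ {c | ∀ a ∉ A, c a = none}
  have hL := finite_nodup_lists (hfin.prod (finite_functions (β := Fin (K + 1)) hA))
  refine ⟨Set.ncard {l : List (State L × (ℕ → Option (Fin (K + 1)))) |
    l.Nodup ∧ ∀ x ∈ l, x ∈ F}, fun m C h hlen => ?_⟩
  have hwf : ∀ {k P}, k ≤ m → P <+: (C k).stack → Γ.WellFormed nm P := fun hk hP =>
    (h.reached_of_le hk).proper.wf.of_prefix hP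
  set V := bound (Γ.top (C 0).stack.dropLast).bind ∪ bound (Γ.top (C 0).stack).bind
  have hb : ∀ {P : Stack L}, P <+: (C 0).stack → (bound (Γ.top P).bind).Finite ∧
      (bound (Γ.top P).bind).ncard ≤ A.ncard := fun hP => by
    have hp := (hwf (Nat.zero_le m) hP).proper
    have hs := hp.bound_subset (hpA _ hp.isState)
    exact ⟨(hA.image _).subset hs,
      (Set.ncard_le_ncard hs (hA.image _)).trans (Set.ncard_image_le hA)⟩
  have hb₁ := hb (List.dropLast_prefix (C 0).stack)
  have hb₂ := hb (List.prefix_refl (C 0).stack)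
  obtain ⟨f, hf⟩ := exists_injOn_fin (V := V) (hb₁.1.union hb₂.1) (K := K)
    ((Set.ncard_union_le _ _).trans (Nat.add_le_add hb₁.2 hb₂.2))
  set d := (C 0).stack.length - 1
  set E : Set (Literal L ℕ × BState L) :=
    {x | bound x.2.bind ⊆ V ∧ x.2.Proper Γ nm ∧ ∃ P, Γ.WellFormed nm (P ++ [x])} with hE
  have hmem : ∀ k ≤ m, ∀ x ∈ (C k).stack.drop d, x ∈ E := by
    intro k hk x hx
    obtain ⟨P, hP, hd⟩ := exists_prefix_of_mem_drop hx
    have h1 := h.bound_subset hlen hk hP (by rw [List.length_append]; omega)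
    have h2 := hwf hk hP
    have h3 := h2.proper
    rw [top_concat] at h1 h3
    exact ⟨h1, h3, P, h2⟩
  have hsnd : Set.InjOn Prod.snd E := by
    rintro ⟨e, q⟩ ⟨-, -, P, hP⟩ ⟨e', q'⟩ ⟨-, -, P', hP'⟩ heq
    obtain rfl : q = q' := heq
    obtain ⟨ℓ, hr⟩ := hP.exists_read
    obtain ⟨ℓ', hr'⟩ := hP'.exists_read
    rw [hr.literal_eq hr']
  set φ : ℕ → List (State L × (ℕ → Option (Fin (K + 1)))) := fun k =>
    (((C k).stack.drop d).map Prod.snd).map (BState.encode f) with hφ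
  have hmem' : ∀ k ≤ m, ∀ q ∈ ((C k).stack.drop d).map Prod.snd,
      bound q.bind ⊆ V ∧ q.Proper Γ nm := by
    intro k hk q hq
    obtain ⟨x, hx, rfl⟩ := List.mem_map.1 hq
    exact ⟨(hmem k hk x hx).1, (hmem k hk x hx).2.1⟩
  -- The code at time `k` determines the stack: first the states with bindings, then by `hsnd` their
  -- literals, while everything below height `d` is unchanged. As stacks do not recur, the `m + 1`
  -- codes are distinct.
  have hinj : Set.InjOn φ (Set.Iic m) := by
    have hne : ∀ i j, i < j → j ≤ m → φ i ≠ φ j := by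
      intro i j hij hj heq
      have h1 := map_injOn (BState.encode_injOn hf) (fun q hq => (hmem' i (by omega) q hq).1)
        (fun q hq => (hmem' j hj q hq).1) heq
      have h2 := map_injOn hsnd (hmem i (by omega)) (hmem j hj) h1
      refine h.stack_ne hred hlhs hconf hij hj ?_
      rw [← List.take_append_drop d (C i).stack, ← List.take_append_drop d (C j).stack, h2,
        h.take_eq hlen hj, h.take_eq hlen (hij.le.trans hj)]
    intro i hi j hj heq
    rcases lt_trichotomy i j with hij | hij | hij
    · exact absurd heq (hne i j hij hj)
    · exact hij
    · exact absurd heq.symm (hne j i hij hi)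
  have hmaps : φ '' Set.Iic m ⊆ {l | l.Nodup ∧ ∀ x ∈ l, x ∈ F} := by
    rintro _ ⟨k, hk, rfl⟩
    refine ⟨(h.nodup_drop hred hlhs hconf hk).map_on fun q hq q' hq' heq =>
      BState.encode_injOn hf (hmem' k hk q hq).1 (hmem' k hk q' hq').1 heq, fun x hx => ?_⟩
    obtain ⟨q, hq, rfl⟩ := List.mem_map.1 hx
    have hq' := (hmem' k hk q hq).2
    refine ⟨hq'.isState, fun a ha => ?_⟩
    by_contra hne
    refine ha (hpA _ hq'.isState ((hq'.bind_ne_none a).1 fun hn => hne ?_))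
    simp [BState.encode, hn]
  have hcard := Set.ncard_le_ncard hmaps hL
  rw [hinj.ncard_image, Set.ncard_eq_toFinset_card', Set.toFinset_Iic, Nat.card_Iic] at hcard
  exact hcard

/-- The amortized number of moves: the height of the stack is the potential. -/
theorem amortized_bound {c : ℕ} (hc : ∀ (m : ℕ) (C : ℕ → Config L), ReduceRun Γ nm m C →
      (∀ k ≤ m, (C 0).stack.length ≤ (C k).stack.length) → m < c)
    (n : ℕ) (C : ℕ → Config L) (h0 : Γ.Reached nm (C 0))
    (hs : ∀ i < n, Γ.Step nm (C i) (C (i + 1))) :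
    ∃ s, (C n).graph.length = (C 0).graph.length + s ∧
      n + c * (C n).stack.length ≤ c * (C 0).stack.length + (c + c * c) * (s + 1) := by
  induction n using Nat.strong_induction_on generalizing C with
  | _ n ih =>
    have hheight : ∀ i ≤ n, (C i).stack.length ≤ (C 0).stack.length + i := by
      intro i hi
      induction i with
      | zero => exact le_rfl
      | succ i ihi =>
        have := ihi (by omega)
        rcases (hs i hi).exists_concat with ⟨-, x, hx⟩ | ⟨-, R, x, hR, hx⟩
        · rw [hx, List.length_append, List.length_singleton]
          omega
        · have := hR.length_le
          rw [hx, List.length_append, List.length_singleton]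
          omega
    set Good : ℕ → Prop := fun a => ReduceRun Γ nm a C ∧
      ∀ k ≤ a, (C 0).stack.length ≤ (C k).stack.length with hGood
    have hgood : Good 0 := ⟨⟨h0, by simp, by simp⟩, fun k hk => by rw [Nat.le_zero.1 hk]⟩
    have hreach : ∀ i ≤ n, Γ.Reached nm (C i) := by
      intro i hi
      induction i with
      | zero => exact h0
      | succ i ihi => exact (ihi (by omega)).tail (hs i hi)
    -- The initial reduce run that stays at or above the initial height either is the entire
    -- sequence or is maximal with length `a < n`.
    have hsplit : Good n ∨ ∃ a < n, Good a ∧ ¬ Good (a + 1) := by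
      by_contra! hcon
      have : ∀ a ≤ n, Good a := by
        intro a ha
        induction a with
        | zero => exact hgood
        | succ a iha => exact hcon.2 a ha (iha (by omega))
      exact hcon.1 (this n le_rfl)
    rcases hsplit with hn | ⟨a, ha, hga, hna⟩
    · refine ⟨0, by rw [hn.1.graph_eq le_rfl]; rfl, ?_⟩
      have h1 := hc n C hn.1 hn.2
      have h2 := hheight n le_rfl
      have h3 : c * (C n).stack.length ≤ c * ((C 0).stack.length + c) :=
        Nat.mul_le_mul_left _ (by omega)
      rw [Nat.mul_add] at h3
      omega
    · have h1 := hc a C hga.1 hga.2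
      have h2 := hheight a ha.le
      obtain ⟨s, hs1, hs2⟩ := ih (n - (a + 1)) (by omega) (fun i => C (a + 1 + i))
        (hreach _ ha) (fun i hi => hs (a + 1 + i) (by omega))
      have hna' : a + 1 + (n - (a + 1)) = n := by omega
      rw [hna', Nat.add_zero] at hs1 hs2
      have hga' := hga.1.graph_eq le_rfl
      rcases (hs a ha).exists_concat with ⟨hl, x, hx⟩ | ⟨hl, -⟩
      -- The run is ended by a shift: at most `c` moves raise the height by at most `c`, at a cost
      -- of `c + c * c`, which the literal read pays.
      · refine ⟨s + 1, by rw [hs1, hl, hga']; omega, ?_⟩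
        have h3 : c * (C (a + 1)).stack.length ≤ c * ((C 0).stack.length + c) := by
          refine Nat.mul_le_mul_left _ ?_
          rw [hx, List.length_append, List.length_singleton]
          omega
        rw [Nat.mul_add] at h3
        rw [Nat.mul_add _ (s + 1) 1]
        omega
      · refine ⟨s, by rw [hs1, hl, hga'], ?_⟩
        -- The run is ended by a reduction, so the height must have dropped below the initial one,
        -- releasing potential `c` for the at most `c` moves.
        have h3 : (C (a + 1)).stack.length + 1 ≤ (C 0).stack.length := by
          by_contra hlt
          refine hna ⟨⟨h0, fun i hi => hs i (by omega), fun i hi => ?_⟩, fun k hk => ?_⟩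
          · rcases Nat.lt_or_ge i a with hia | hia
            · exact hga.1.length_eq i hia
            · obtain rfl : i = a := by omega
              exact hl
          · rcases Nat.lt_or_ge a k with hak | hak
            · obtain rfl : k = a + 1 := by omega
              omega
            · exact hga.2 k hak
        have h4 := Nat.mul_le_mul_left c h3
        rw [Nat.mul_add, Nat.mul_one] at h4
        omega

end PSR

theorem mainTheorem2 {L : Type*} (Γ : PSR.HRGrammar L) (hred : Γ.Reduced)
    (nm : PSR.Naming L) (hfin : (Γ.states nm).Finite) (hlhs : Γ.LhsKnown nm)
    (hconf : ∀ Q ∈ Γ.states nm, Γ.ConflictFree nm Q) :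
    (∃ c : ℕ, ∀ (n : ℕ) (C : ℕ → PSR.Config L),
      Γ.Reached nm (C 0) →
      (∀ i < n, Γ.Step nm (C i) (C (i + 1))) →
      (∀ i, 1 ≤ i → i ≤ n → (C 0).stack <+: (C i).stack) →
      (n : ℤ) < (c : ℤ) * (((C n).graph.length : ℤ) - ((C 0).graph.length : ℤ) + 1)) ∧
    (∃ c : ℕ, ∀ (n : ℕ) (C : ℕ → PSR.Config L),
      C 0 = Γ.initConfig →
      (∀ i < n, Γ.Step nm (C i) (C (i + 1))) →
      n < c * (C n).graph.length + c) := by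
  obtain ⟨c, hc⟩ := PSR.exists_reduceRun_bound hred hfin hlhs hconf
  have key : ∀ (n : ℕ) (C : ℕ → PSR.Config L), Γ.Reached nm (C 0) →
      (∀ i < n, Γ.Step nm (C i) (C (i + 1))) →
      (∀ i, 1 ≤ i → i ≤ n → (C 0).stack <+: (C i).stack) →
      (n : ℤ) < ((c + c * c + 1 : ℕ) : ℤ) *
        (((C n).graph.length : ℤ) - ((C 0).graph.length : ℤ) + 1) := by
    intro n C h0 hs hpre
    obtain ⟨s, hs1, hs2⟩ := PSR.amortized_bound hc n C h0 hs
    have hlen : (C 0).stack.length ≤ (C n).stack.length := by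
      rcases Nat.eq_zero_or_pos n with rfl | hn
      · exact le_rfl
      · exact (hpre n hn le_rfl).length_le
    -- The final stack is no lower than the initial one, so the potential cancels in favour of the
    -- bound; the extra 1 in the constant makes the inequality strict.
    have h1 : n < (c + c * c + 1) * (s + 1) := by
      have := Nat.mul_le_mul_left c hlen
      rw [Nat.add_mul _ 1]
      omega
    rw [hs1, Nat.cast_add (C 0).graph.length, add_sub_cancel_left]
    exact_mod_cast h1
  refine ⟨⟨_, key⟩, c + c * c + 1, fun n C h0 hs => ?_⟩
  have h1 := key n C (h0 ▸ .refl) hs fun i _ _ => by rw [h0]; exact List.nil_prefix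
  have h2 : (C 0).graph.length = 0 := by rw [h0]; rfl
  rw [h2, Nat.cast_zero, sub_zero] at h1
  rw [← Nat.mul_succ]
  exact_mod_cast h1
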